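/- Let $K$ be a field of characteristic zero and let $A_n(K)$ be the Weyl algebra generated over $K$ by $x_1,\dots,x_n,\partial_1,\dots,\partial_n$ with the relations $x_ix_j=x_jx_i$, $\partial_i\partial_j=\partial_j\partial_i$, $\partial_ix_j=x_j\partial_i$ for $i\neq j$, and $\partial_ix_i=x_i\partial_i+1$. Fix a partition of $\{1,\dots,n\}$ into $p$ blocks $N_1,\dots,N_p$ (empty blocks are allowed) and put $n_j=|N_j|$. For $r\in\mathbb{Z}^p$ let $W_r$ be the $K$-linear span of the monomials $x^\alpha\partial^\beta$ with $\sum_{i\in N_j}(\alpha_i+\beta_i)\le r_j$ for $j=1,\dots,p$ (so $W_r=0$ if some $r_j<0$). Let $M$ be a finitely generated left $A_n(K)$-module. For a finite system of generators $f=(f_1,\dots,f_m)$ of $M$, the dimension polynomial of $M$ associated with $f$ is the polynomial $\phi_M\in\mathbb{Q}[t_1,\dots,t_p]$ such that $\phi_M(r)=\dim_K\sum_{i=1}^mW_rf_i$ for all sufficiently large $r\in\mathbb{Z}^p$ (that is, for all $r$ with $r_j\ge s_j$, $1\le j\le p$, for some $s\in\mathbb{Z}^p$). **Theorem 4.4.**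 For every finite system of generators of $M$ there is exactly one associated dimension polynomial, and it can be written in exactly one way as $$\phi_M(t_1,\dots,t_p)=\sum_{i_1=0}^{2n_1}\cdots\sum_{i_p=0}^{2n_p}a_{i_1\dots i_p}\binom{t_1+i_1}{i_1}\cdots\binom{t_p+i_p}{i_p}$$ with integers $a_{i_1\dots i_p}$. Let $S(\phi_M)=\{(i_1,\dots,i_p): a_{i_1\dots i_p}\ne 0\}$, and let $S(\phi_M)'$ be the set of those elements of $S(\phi_M)$ that are maximal in $S(\phi_M)$ for at least one of the $p!$ lexicographic orders on $\mathbb{N}^p$ (one for each order in which the coordinates can be compared). Then the following do not depend on the finite system of generators of $M$ with which $\phi_M$ is associated: 1. the total degree $d=\deg\phi_M$; 2. the coefficient $a_{2n_1,\dots,2n_p}$; likewise the degrees $D_j=\deg_{t_j}\phi_M$ ($1\le j\le p$) and the coefficient $a_{D_1,\dots,D_p}$; 3. the set $S(\phi_M)'$ and the coefficients $a_{k_1\dots k_p}$ with $(k_1,\dots,k_p)\in S(\phi_M)'$; 4. the coefficients of the terms of total degree $d$, that is, the $a_{k_1\dots k_p}$ with $k_1+\dots+k_p=d$, and likewise the coefficients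 of the monomials $t_1^{k_1}\cdots t_p^{k_p}$ with $k_1+\dots+k_p=d$ in $\phi_M$. (The degrees of the zero polynomial are taken to be $0$.) -/

import Mathlib

noncomputable section

namespace WeylDim

/-- The defining relations of the `n`-th Weyl algebra; `Sum.inl i` stands for the variable `x i`
and `Sum.inr i` for the partial derivative `∂ i`. -/
inductive Rel (K : Type*) [Field K] (n : ℕ) :
    FreeAlgebra K (Fin n ⊕ Fin n) → FreeAlgebra K (Fin n ⊕ Fin n) → Prop
  | x_comm (i j : Fin n) :
      Rel K n (FreeAlgebra.ι K (Sum.inl i) * FreeAlgebra.ι K (Sum.inl j))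
        (FreeAlgebra.ι K (Sum.inl j) * FreeAlgebra.ι K (Sum.inl i))
  | d_comm (i j : Fin n) :
      Rel K n (FreeAlgebra.ι K (Sum.inr i) * FreeAlgebra.ι K (Sum.inr j))
        (FreeAlgebra.ι K (Sum.inr j) * FreeAlgebra.ι K (Sum.inr i))
  | d_x_of_ne (i j : Fin n) (hij : i ≠ j) :
      Rel K n (FreeAlgebra.ι K (Sum.inr i) * FreeAlgebra.ι K (Sum.inl j))
        (FreeAlgebra.ι K (Sum.inl j) * FreeAlgebra.ι K (Sum.inr i))
  | d_x (i : Fin n) :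
      Rel K n (FreeAlgebra.ι K (Sum.inr i) * FreeAlgebra.ι K (Sum.inl i))
        (FreeAlgebra.ι K (Sum.inl i) * FreeAlgebra.ι K (Sum.inr i) + 1)

/-- The Weyl algebra `A_n(K)`, by generators and relations. -/
abbrev WeylAlgebra (K : Type*) [Field K] (n : ℕ) := RingQuot (Rel K n)

/-- The generator `x i` of `A_n(K)`. -/
def x (K : Type*) [Field K] {n : ℕ} (i : Fin n) : WeylAlgebra K n :=
  RingQuot.mkAlgHom K (Rel K n) (FreeAlgebra.ι K (Sum.inl i))

/-- The generator `∂ i` of `A_n(K)`. -/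
def d (K : Type*) [Field K] {n : ℕ} (i : Fin n) : WeylAlgebra K n :=
  RingQuot.mkAlgHom K (Rel K n) (FreeAlgebra.ι K (Sum.inr i))

/-- The monomial `x^α ∂^β = x_1^{α_1} ⋯ x_n^{α_n} ∂_1^{β_1} ⋯ ∂_n^{β_n}`. -/
def mono (K : Type*) [Field K] {n : ℕ} (α β : Fin n → ℕ) : WeylAlgebra K n :=
  (List.ofFn fun i => x K i ^ α i).prod * (List.ofFn fun i => d K i ^ β i).prod

/-- The number of variables in the `j`-th block of the partition of `{x_1, …, x_n}` in which
`x i` lies in the block `c i`. -/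
def blockSize {n p : ℕ} (c : Fin n → Fin p) (j : Fin p) : ℕ :=
  (Finset.univ.filter fun i => c i = j).card

/-- The `j`-th order of the monomial `x^α ∂^β`: its degree in the variables and the partial
derivatives of the `j`-th block. -/
def ordMono {n p : ℕ} (c : Fin n → Fin p) (j : Fin p) (α β : Fin n → ℕ) : ℕ :=
  ∑ i ∈ Finset.univ.filter (fun i => c i = j), (α i + β i)

/-- The component `W_r` of the `p`-dimensional filtration of `A_n(K)`: the `K`-span of the
monomials of `j`-th order at most `r j` for all `j`. If some `r j` is negative there is no such
monomial, and `W_r = 0`. -/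
def W (K : Type*) [Field K] {n p : ℕ} (c : Fin n → Fin p) (r : Fin p → ℤ) :
    Submodule K (WeylAlgebra K n) :=
  Submodule.span K
    {D | ∃ α β : Fin n → ℕ, (∀ j, (ordMono c j α β : ℤ) ≤ r j) ∧ D = mono K α β}

/-- The component `M_r = ∑ i, W_r • f i` of the filtration of a `D`-module that is associated with
the family `f`. -/
def filt (K : Type*) [Field K] {n p : ℕ} (c : Fin n → Fin p)
    {M : Type*} [AddCommGroup M] [Module K M] [Module (WeylAlgebra K n) M]
    [IsScalarTower K (WeylAlgebra K n) M] {m : ℕ} (f : Fin m → M) (r : Fin p → ℤ) :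
    Submodule K M :=
  ⨆ i, (W K c r).map ((LinearMap.toSpanSingleton (WeylAlgebra K n) M (f i)).restrictScalars K)

/-- `φ` is the dimension polynomial associated with the family `f`:
`φ(r) = dim_K M_r` for all sufficiently large `r ∈ ℤ^p`. -/
def IsDimensionPolynomial (K : Type*) [Field K] {n p : ℕ} (c : Fin n → Fin p)
    {M : Type*} [AddCommGroup M] [Module K M] [Module (WeylAlgebra K n) M]
    [IsScalarTower K (WeylAlgebra K n) M] {m : ℕ} (f : Fin m → M)
    (φ : MvPolynomial (Fin p) ℚ) : Prop :=
  ∃ s : Fin p → ℤ, ∀ r : Fin p → ℤ, s ≤ r →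
    MvPolynomial.eval (fun j => (r j : ℚ)) φ = (Module.finrank K (filt K c f r) : ℚ)

/-- The polynomial `(t_j + k choose k) = (t_j + 1)(t_j + 2) ⋯ (t_j + k) / k!`. -/
def binom {p : ℕ} (j : Fin p) (k : ℕ) : MvPolynomial (Fin p) ℚ :=
  MvPolynomial.C ((k.factorial : ℚ)⁻¹) *
    ∏ l ∈ Finset.range k, (MvPolynomial.X j + MvPolynomial.C ((l : ℚ) + 1))

/-- `φ = ∑ a_k ∏ j, (t_j + k_j choose k_j)`, the sum being over all `k` with
`0 ≤ k_j ≤ 2 n_j`, with integer coefficients `a_k`. -/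
def HasExpansion {n p : ℕ} (c : Fin n → Fin p) (φ : MvPolynomial (Fin p) ℚ)
    (a : (Fin p → ℕ) →₀ ℤ) : Prop :=
  (∀ k ∈ a.support, ∀ j, k j ≤ 2 * blockSize c j) ∧
    φ = ∑ k ∈ a.support, MvPolynomial.C (a k : ℚ) * ∏ j, binom j (k j)

/-- The elements of `S ⊆ ℕ^p` that are maximal in `S` for at least one of the `p!` lexicographic
orders, which compare the coordinates in the order `σ 0, σ 1, …` for a permutation `σ`. -/
def lexMaximal {p : ℕ} (S : Set (Fin p → ℕ)) : Set (Fin p → ℕ) :=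
  {k | k ∈ S ∧ ∃ σ : Equiv.Perm (Fin p), ∀ l ∈ S, toLex (l ∘ σ) ≤ toLex (k ∘ σ)}

end WeylDim

end

noncomputable section

namespace WeylDim

open Finset

/-! ### Numerical functions of one variable -/

/-! Existence. Order the elements `x^α ∂^β f_i` first by `i`, then lexicographically by exponent.
The dimension of the component `M_r` is the number of indices of multidegree at most `r` whose
element is not a combination of smaller ones of multidegree at most `r`
(`finrank_span_image_eq_ncard`). One homogenizing variable per block takes up the slack between a
multidegree and `r`. Since a product of a generator and a monomial is a monomial plus a multiple of
a smaller one, the irreducible homogenized exponents form a lower set for each `i`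
(`isLowerSet_irreducibleSet`). The Hilbert function of a lower set is found by induction on the
number of variables (`hilb_mem_countSpan`): by Dickson's lemma its slices along one coordinate
stabilize, and each variable costs one summation, which raises a binomial index by one. Block `j`
has `2 n_j + 1` variables, hence the indices `0, …, 2 n_j`.

Invariance. Two generating systems have filtrations that contain each other up to a shift, so `φ(r)
≤ φ'(r + q)` for large `r`, and conversely. Along the curve `r_j = ρ_j N ^ w_j` with positive
weights `w`, only the part of highest weight survives as `N` grows, and the shift is invisible;
hence these parts agree (`coeff_eq_of_forall_wt_le`). The weight `1` gives the total degree and its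
terms, a weight dominated by `t_j` gives the degree in `t_j`, and rapidly decreasing weights give
the lexicographic orders. Binomial products are triangular in the monomials for the componentwise
order, which carries the results over to the coefficients `a_k` (`HasExpansion.forall_eq_zero_iff`).
-/

/-- The function `r ↦ (r + i choose i)` on `ℤ`. -/
def binomFun (i : ℕ) (r : ℤ) : ℚ :=
  (i.factorial : ℚ)⁻¹ * ∏ l ∈ range i, ((r : ℚ) + ((l : ℚ) + 1))

lemma binomFun_zero (r : ℤ) : binomFun 0 r = 1 := by simp [binomFun]

lemma binomFun_succ_sub (i : ℕ) (r : ℤ) :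
    binomFun (i + 1) r - binomFun (i + 1) (r - 1) = binomFun i r := by
  have h1 : ∏ l ∈ range (i + 1), ((r : ℚ) + ((l : ℚ) + 1)) =
      (∏ l ∈ range i, ((r : ℚ) + ((l : ℚ) + 1))) * (r + (i + 1)) := prod_range_succ _ _
  have h2 : ∏ l ∈ range (i + 1), (((r - 1 : ℤ) : ℚ) + ((l : ℚ) + 1)) =
      (∏ l ∈ range i, ((r : ℚ) + ((l : ℚ) + 1))) * r := by
    rw [prod_range_succ']
    congr 1
    · refine prod_congr rfl fun l _ => ?_
      push_cast; ring
    · push_cast; ring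
  have h3 : ((i + 1).factorial : ℚ) = (i + 1) * i.factorial := by
    rw [Nat.factorial_succ]; push_cast; ring
  have h4 : (i.factorial : ℚ) ≠ 0 := by exact_mod_cast i.factorial_ne_zero
  have h5 : (i + 1 : ℚ) ≠ 0 := by positivity
  unfold binomFun
  rw [h1, h2, h3]
  field_simp
  ring

lemma binomFun_natCast (i n : ℕ) : binomFun i n = ((n + i).choose i : ℚ) := by
  have h : ∏ l ∈ range i, (((n : ℤ) : ℚ) + ((l : ℚ) + 1)) =
      ((i.factorial * (n + i).choose i : ℕ) : ℚ) := by
    rw [← Nat.ascFactorial_eq_factorial_mul_choose, Nat.ascFactorial_eq_prod_range]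
    push_cast
    exact prod_congr rfl fun l _ => by ring
  have h4 : (i.factorial : ℚ) ≠ 0 := by exact_mod_cast i.factorial_ne_zero
  rw [binomFun, h]
  push_cast
  field_simp

/-- The `ℤ`-span of the functions `r ↦ (r + i choose i)` with `i < k`. -/
def binomSpan (k : ℕ) : Submodule ℤ (ℤ → ℚ) :=
  Submodule.span ℤ (Set.range fun i : Fin k => binomFun i)

lemma binomFun_mem {i k : ℕ} (h : i < k) : binomFun i ∈ binomSpan k :=
  Submodule.subset_span ⟨⟨i, h⟩, rfl⟩

lemma binomSpan_mono {k l : ℕ} (h : k ≤ l) : binomSpan k ≤ binomSpan l := by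
  refine Submodule.span_le.2 ?_
  rintro _ ⟨i, rfl⟩
  exact binomFun_mem (i.2.trans_le h)

/-- Pascal's rule expresses a shifted binomial as an integer combination of unshifted ones. -/
lemma shift_one_mem_binomSpan {k : ℕ} {q : ℤ → ℚ} (hq : q ∈ binomSpan k) :
    (fun r => q (r - 1)) ∈ binomSpan k := by
  induction hq using Submodule.span_induction with
  | mem q h =>
    obtain ⟨⟨i, hi⟩, rfl⟩ := h
    cases i with
    | zero =>
      convert binomFun_mem hi using 2
      simp [binomFun_zero]
    | succ i =>
      have : (fun r => binomFun (i + 1) (r - 1)) = binomFun (i + 1) - binomFun i := by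
        funext r
        have := binomFun_succ_sub i r
        simp only [Pi.sub_apply]
        linarith
      change (fun r => binomFun (i + 1) (r - 1)) ∈ _
      rw [this]
      exact sub_mem (binomFun_mem hi) (binomFun_mem (by omega))
  | zero => exact zero_mem _
  | add q q' _ _ h h' => exact add_mem h h'
  | smul z q _ h => exact Submodule.smul_mem _ z h

lemma shift_mem_binomSpan {k : ℕ} {q : ℤ → ℚ} (hq : q ∈ binomSpan k) (b : ℕ) :
    (fun r => q (r - b)) ∈ binomSpan k := by
  induction b with
  | zero => simpa using hq
  | succ b ih =>
    convert shift_one_mem_binomSpan ih using 2 with r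
    push_cast; ring_nf

lemma exists_antidifference {k : ℕ} {q : ℤ → ℚ} (hq : q ∈ binomSpan k) :
    ∃ Q ∈ binomSpan (k + 1), ∀ r, Q r - Q (r - 1) = q r := by
  induction hq using Submodule.span_induction with
  | mem q h =>
    obtain ⟨⟨i, hi⟩, rfl⟩ := h
    exact ⟨binomFun (i + 1), binomFun_mem (by omega), binomFun_succ_sub i⟩
  | zero => exact ⟨0, zero_mem _, by simp⟩
  | add q q' _ _ h h' =>
    obtain ⟨Q, hQ, h⟩ := h
    obtain ⟨Q', hQ', h'⟩ := h'
    refine ⟨Q + Q', add_mem hQ hQ', fun r => ?_⟩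
    simp only [Pi.add_apply, ← h, ← h']
    ring
  | smul z q _ h =>
    obtain ⟨Q, hQ, h⟩ := h
    refine ⟨z • Q, Submodule.smul_mem _ z hQ, fun r => ?_⟩
    simp only [Pi.smul_apply, ← h, smul_sub]

/-- Needed to keep the constant of summation an integer in `IsCount.of_difference`. -/
lemma exists_int_of_mem_binomSpan {k : ℕ} {q : ℤ → ℚ} (hq : q ∈ binomSpan k) (n : ℕ) :
    ∃ z : ℤ, q n = z := by
  induction hq using Submodule.span_induction with
  | mem q h =>
    obtain ⟨⟨i, hi⟩, rfl⟩ := h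
    exact ⟨((n + i).choose i : ℕ), (binomFun_natCast i n).trans (by simp)⟩
  | zero => exact ⟨0, by simp⟩
  | add q q' _ _ h h' =>
    obtain ⟨z, h⟩ := h
    obtain ⟨z', h'⟩ := h'
    exact ⟨z + z', by simp [h, h']⟩
  | smul y q _ h =>
    obtain ⟨z, h⟩ := h
    exact ⟨y * z, by simp [h]⟩

/-- Functions on `ℤ` that vanish on negative arguments and agree with an element of `binomSpan k`
on all large arguments. -/
def IsCount (k : ℕ) (g : ℤ → ℤ) : Prop :=
  (∀ r < 0, g r = 0) ∧ ∃ q ∈ binomSpan k, ∃ s : ℤ, ∀ r, s ≤ r → (g r : ℚ) = q r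

lemma IsCount.mono {k l : ℕ} {g : ℤ → ℤ} (hg : IsCount k g) (h : k ≤ l) : IsCount l g :=
  ⟨hg.1, hg.2.imp fun _ hq => ⟨binomSpan_mono h hq.1, hq.2⟩⟩

lemma isCount_zero_indicator : IsCount 0 fun r => if r = 0 then 1 else 0 := by
  refine ⟨fun r hr => by simp [hr.ne], 0, zero_mem _, 1, fun r hr => ?_⟩
  have : r ≠ 0 := by omega
  simp [this]

lemma IsCount.shift {k : ℕ} {g : ℤ → ℤ} (hg : IsCount k g) (b : ℕ) :
    IsCount k fun r => g (r - b) := by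
  obtain ⟨h0, q, hq, s, hs⟩ := hg
  exact ⟨fun r hr => h0 _ (by omega), _, shift_mem_binomSpan hq b, s + b,
    fun r hr => hs _ (by omega)⟩

/-- `G` and an antidifference of the eventual form of `g` have the same differences from some point
on, so they differ there by a constant, a multiple of `binomFun 0`. -/
lemma IsCount.of_difference {k : ℕ} {g G : ℤ → ℤ} (hg : IsCount k g)
    (h0 : ∀ r < 0, G r = 0) (h : ∀ r, G r = G (r - 1) + g r) : IsCount (k + 1) G := by
  obtain ⟨-, q, hq, s, hs⟩ := hg
  obtain ⟨Q, hQ, hd⟩ := exists_antidifference hq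
  -- A natural starting point, because integrality of `Q` is known only at natural arguments.
  obtain ⟨s', hs'⟩ : ∃ s' : ℕ, s ≤ s' := ⟨s.toNat, Int.self_le_toNat s⟩
  obtain ⟨z, hz⟩ := exists_int_of_mem_binomSpan hQ s'
  refine ⟨h0, Q + (G s' - z) • binomFun 0,
    add_mem hQ (Submodule.smul_mem _ _ (binomFun_mem (by omega))), s', fun r hr => ?_⟩
  induction r, hr using Int.leInduction with
  | base => simp [binomFun_zero, hz]
  | succ r hr ih =>
    have h1 := h (r + 1)
    have h2 := hd (r + 1)
    have h3 := hs (r + 1) (by omega)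
    rw [add_sub_cancel_right] at h1 h2
    simp only [Pi.add_apply, Pi.smul_apply, binomFun_zero] at ih ⊢
    rw [h1, Int.cast_add, ih, h3, ← h2]
    ring

lemma IsCount.exists_sum {k : ℕ} {g : ℤ → ℤ} (hg : IsCount k g) (b : ℕ) :
    ∃ G, IsCount (k + 1) G ∧ (∀ r, G r = G (r - 1) + g (r - b)) := by
  have hd : ∀ r : ℤ, ∑ t ∈ Icc 0 (r - b), g t = ∑ t ∈ Icc 0 (r - 1 - b), g t + g (r - b) := by
    intro r
    by_cases hr : 0 ≤ r - b
    · have : Icc (0 : ℤ) (r - b) = insert (r - b) (Icc 0 (r - 1 - b)) := by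
        ext t; simp only [mem_Icc, mem_insert]; omega
      rw [this, sum_insert (by simp), add_comm]
    · rw [Icc_eq_empty (by omega), Icc_eq_empty (by omega), hg.1 _ (by omega)]
      simp
  refine ⟨fun r => ∑ t ∈ Icc 0 (r - b), g t, (hg.shift b).of_difference ?_ hd, hd⟩
  intro r hr
  rw [Icc_eq_empty (by omega), sum_empty]

/-! ### Numerical functions of several variables -/

/-- Finite sums of products `r ↦ ∏ j, g j (r j)` with `IsCount (κ j) (g j)`. -/
def countSpan {p : ℕ} (κ : Fin p → ℕ) : AddSubmonoid ((Fin p → ℤ) → ℤ) :=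
  AddSubmonoid.closure
    {H | ∃ g : Fin p → ℤ → ℤ, (∀ j, IsCount (κ j) (g j)) ∧ H = fun r => ∏ j, g j (r j)}

variable {p : ℕ}

/-- A shift alone would preserve `κ`; the larger index makes the result addable to the sums from
`countSpan_of_difference`. -/
lemma countSpan_shift {κ : Fin p → ℕ} {H : (Fin p → ℤ) → ℤ} (hH : H ∈ countSpan κ) (j : Fin p)
    (b : ℕ) : (fun r => H (r - Pi.single j (b : ℤ))) ∈ countSpan (Pi.single j 1 + κ) := by
  induction hH using AddSubmonoid.closure_induction with
  | mem H h =>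
    obtain ⟨g, hg, rfl⟩ := h
    refine AddSubmonoid.subset_closure
      ⟨fun i r => g i (r - Pi.single (M := fun _ => ℤ) j (b : ℤ) i), fun i => ?_, rfl⟩
    by_cases hi : i = j
    · subst hi
      simpa using ((hg i).shift b).mono (by simp)
    · simpa [Pi.single_eq_of_ne hi] using hg i
  | zero => exact zero_mem _
  | add H H' _ _ h h' => exact add_mem h h'

lemma countSpan_exists_sum {κ : Fin p → ℕ} {H : (Fin p → ℤ) → ℤ} (hH : H ∈ countSpan κ)
    (j : Fin p) (b : ℕ) :
    ∃ G ∈ countSpan (Pi.single j 1 + κ),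
      (∀ r, G r = G (r - Pi.single j 1) + H (r - Pi.single j (b : ℤ))) ∧
      ∀ r : Fin p → ℤ, r j < 0 → G r = 0 := by
  induction hH using AddSubmonoid.closure_induction with
  | mem H h =>
    obtain ⟨g, hg, rfl⟩ := h
    obtain ⟨G, hG, hd⟩ := (hg j).exists_sum b
    refine ⟨fun r => ∏ i, Function.update g j G i (r i), AddSubmonoid.subset_closure
      ⟨Function.update g j G, fun i => ?_, rfl⟩, fun r => ?_, fun r hr => ?_⟩
    · by_cases hi : i = j
      · subst hi
        simpa [add_comm] using hG
      · simpa [hi] using hg i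
    · simp only [← mul_prod_erase univ _ (mem_univ j), Function.update_self, Pi.sub_apply,
        Pi.single_eq_same]
      have h1 : ∀ i ∈ univ.erase j, Function.update g j G i (r i - Pi.single (M := fun _ => ℤ) j 1 i)
          = g i (r i) := fun i hi => by simp [(mem_erase.1 hi).1]
      have h2 : ∀ i ∈ univ.erase j, g i (r i - Pi.single (M := fun _ => ℤ) j (b : ℤ) i)
          = g i (r i) := fun i hi => by simp [(mem_erase.1 hi).1]
      have h3 : ∀ i ∈ univ.erase j, Function.update g j G i (r i)
          = g i (r i) := fun i hi => by simp [(mem_erase.1 hi).1]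
      rw [prod_congr rfl h1, prod_congr rfl h2, prod_congr rfl h3, hd, add_mul]
    · refine prod_eq_zero (mem_univ j) ?_
      simpa using hG.1 _ hr
  | zero => exact ⟨0, zero_mem _, by simp, by simp⟩
  | add H H' _ _ h h' =>
    obtain ⟨G, hG, h1, h2⟩ := h
    obtain ⟨G', hG', h1', h2'⟩ := h'
    refine ⟨G + G', add_mem hG hG', fun r => ?_, fun r hr => ?_⟩
    · simp only [Pi.add_apply]
      rw [h1, h1']
      ring
    · simp [h2 r hr, h2' r hr]

/-- The recursion, with vanishing for negative `r j`, determines `G` by induction on `r j`; so `G`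
is the solution that `countSpan_exists_sum` builds factor by factor. -/
lemma countSpan_of_difference {κ : Fin p → ℕ} {H G : (Fin p → ℤ) → ℤ} (hH : H ∈ countSpan κ)
    (j : Fin p) (b : ℕ)
    (hd : ∀ r, G r = G (r - Pi.single j 1) + H (r - Pi.single j (b : ℤ)))
    (h0 : ∀ r : Fin p → ℤ, r j < 0 → G r = 0) :
    G ∈ countSpan (Pi.single j 1 + κ) := by
  obtain ⟨G', hG', hd', h0'⟩ := countSpan_exists_sum hH j b
  suffices G = G' by rwa [this]
  have key : ∀ (n : ℕ) (r : Fin p → ℤ), r j < n → G r = G' r := by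
    intro n
    induction n with
    | zero =>
      intro r hr
      rw [h0 r (by simpa using hr), h0' r (by simpa using hr)]
    | succ n ih =>
      intro r hr
      rw [hd, hd', ih]
      simp only [Pi.sub_apply, Pi.single_eq_same]
      push_cast at hr
      omega
  funext r
  exact key ((r j).toNat + 1) r (by have := Int.self_le_toNat (r j); push_cast; omega)

/-! ### Counting the points of a lower set of a given multidegree -/

/-- The multidegree of `ξ`, where the variable `v` has degree `e_{c v}`. -/
def mdeg {ι : Type*} [Fintype ι] (c : ι → Fin p) (ξ : ι → ℕ) : Fin p → ℤ :=
  ∑ v, Pi.single (c v) (ξ v : ℤ)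

lemma le_mdeg {ι : Type*} [Fintype ι] (c : ι → Fin p) (ξ : ι → ℕ) (v : ι) :
    (ξ v : ℤ) ≤ mdeg c ξ (c v) := by
  have : (ξ v : ℤ) = Pi.single (M := fun _ => ℤ) (c v) (ξ v : ℤ) (c v) := by simp
  rw [mdeg, Finset.sum_apply, this]
  refine single_le_sum (f := fun v' => Pi.single (M := fun _ => ℤ) (c v') (ξ v' : ℤ) (c v)) ?_ (mem_univ v)
  intro w _
  by_cases h : c v = c w
  · simp [h]
  · simp [Pi.single_eq_of_ne h]

lemma finite_mdeg_eq {ι : Type*} [Fintype ι] (c : ι → Fin p) (r : Fin p → ℤ) :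
    {ξ : ι → ℕ | mdeg c ξ = r}.Finite := by
  refine (Set.Finite.pi' fun v => Set.finite_Iic (r (c v)).toNat).subset fun ξ hξ v => ?_
  have h := le_mdeg c ξ v
  rw [Set.mem_ofPred_eq] at hξ
  rw [hξ] at h
  change ξ v ≤ (r (c v)).toNat
  omega

/-- The number of points of `D` of multidegree `r`. -/
def hilb {ι : Type*} [Fintype ι] (c : ι → Fin p) (D : Set (ι → ℕ)) (r : Fin p → ℤ) : ℤ :=
  ({ξ | ξ ∈ D ∧ mdeg c ξ = r}.ncard : ℤ)

/-- Descending chain condition for lower sets in a well quasi-order; on `ℕ^N` this is Dickson's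
lemma. -/
lemma exists_stable_of_antitone {α : Type*} [Preorder α] [WellQuasiOrderedLE α]
    (D : ℕ → Set α) (hD : ∀ k, IsLowerSet (D k)) (ha : Antitone D) :
    ∃ k₀, ∀ k, k₀ ≤ k → D k = D k₀ := by
  by_contra! hcon
  choose! next hle hne using hcon
  have hex : ∀ k, ∃ a, a ∈ D k ∧ a ∉ D (next k) := fun k => by
    by_contra! h
    exact hne k ((ha (hle k)).antisymm h)
  choose a ha1 ha2 using hex
  let u : ℕ → ℕ := fun i => next^[i] 0
  have hu : ∀ i, u (i + 1) = next (u i) := fun i => Function.iterate_succ_apply' _ _ _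
  have hmono : Monotone u := monotone_nat_of_le_succ fun i => by rw [hu]; exact hle _
  -- For `i < j` the point `a (u j)` lies in `D (u (i + 1))`, and so does the smaller point `a (u
  -- i)`, which was chosen outside.
  obtain ⟨i, j, hij, h⟩ := wellQuasiOrdered_le (fun i => a (u i))
  refine ha2 (u i) ?_
  rw [← hu]
  exact ha (hmono hij) (hD _ h (ha1 (u j)))

lemma mdeg_cons {N : ℕ} (c : Fin (N + 1) → Fin p) (a : ℕ) (ξ : Fin N → ℕ) :
    mdeg c (Fin.cons a ξ : Fin (N + 1) → ℕ) =
      Pi.single (c 0) (a : ℤ) + mdeg (fun v => c v.succ) ξ := by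
  simp [mdeg, Fin.sum_univ_succ]

/-- The number of points of `D` of multidegree `r` whose first coordinate is at least `k`. -/
def hilbGe {N : ℕ} (c : Fin (N + 1) → Fin p) (D : Set (Fin (N + 1) → ℕ)) (k : ℕ)
    (r : Fin p → ℤ) : ℤ :=
  hilb c {ξ | ξ ∈ D ∧ k ≤ ξ 0} r

lemma hilbGe_eq_add {N : ℕ} (c : Fin (N + 1) → Fin p) (D : Set (Fin (N + 1) → ℕ)) (k : ℕ)
    (r : Fin p → ℤ) :
    hilbGe c D k r = hilbGe c D (k + 1) r +
      hilb (fun v => c v.succ) {ξ | (Fin.cons k ξ : Fin (N + 1) → ℕ) ∈ D}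
        (r - Pi.single (c 0) (k : ℤ)) := by
  have h1 : {ξ | ξ ∈ {ξ | ξ ∈ D ∧ k ≤ ξ 0} ∧ mdeg c ξ = r} =
      {ξ | ξ ∈ {ξ | ξ ∈ D ∧ k + 1 ≤ ξ 0} ∧ mdeg c ξ = r} ∪
      (fun ξ : Fin N → ℕ => (Fin.cons k ξ : Fin (N + 1) → ℕ)) ''
        {ξ | ξ ∈ {ξ | (Fin.cons k ξ : Fin (N + 1) → ℕ) ∈ D} ∧
          mdeg (fun v => c v.succ) ξ = r - Pi.single (c 0) (k : ℤ)} := by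
    ext ξ
    constructor
    · rintro ⟨⟨h, hk⟩, hr⟩
      rcases hk.eq_or_lt with hk | hk
      · right
        have hc : (Fin.cons k (Fin.tail ξ) : Fin (N + 1) → ℕ) = ξ := by
          rw [hk]; exact Fin.cons_self_tail ξ
        refine ⟨Fin.tail ξ, ⟨?_, ?_⟩, hc⟩
        · change (Fin.cons k (Fin.tail ξ) : Fin (N + 1) → ℕ) ∈ D
          rwa [hc]
        · rw [eq_sub_iff_add_eq, add_comm, ← mdeg_cons, hc, hr]
      · exact Or.inl ⟨⟨h, hk⟩, hr⟩
    · rintro (⟨⟨h, hk⟩, hr⟩ | ⟨ξ, ⟨h, hr⟩, rfl⟩)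
      · exact ⟨⟨h, by omega⟩, hr⟩
      · refine ⟨⟨h, by simp⟩, ?_⟩
        rw [mdeg_cons, hr]
        abel
  unfold hilbGe hilb
  rw [h1, Set.ncard_union_eq ?_ ((finite_mdeg_eq c r).subset fun ξ h => h.2)
    (((finite_mdeg_eq _ _).subset fun ξ h => h.2).image _),
    Set.ncard_image_of_injective _ (Fin.cons_right_injective (α := fun _ => ℕ) k)]
  · push_cast; rfl
  · rw [Set.disjoint_left]
    rintro _ ⟨⟨-, hk⟩, -⟩ ⟨ξ, -, rfl⟩
    simp at hk

/-- Once the slices are constant, raising the first coordinate by one is a bijection onto the points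
with first coordinate at least `k + 1`. -/
lemma hilbGe_succ_of_stable {N : ℕ} (c : Fin (N + 1) → Fin p) (D : Set (Fin (N + 1) → ℕ)) (k : ℕ)
    (hs : ∀ l, k ≤ l → ∀ ξ : Fin N → ℕ, (Fin.cons l ξ : Fin (N + 1) → ℕ) ∈ D ↔
      (Fin.cons k ξ : Fin (N + 1) → ℕ) ∈ D)
    (r : Fin p → ℤ) :
    hilbGe c D (k + 1) r = hilbGe c D k (r - Pi.single (c 0) 1) := by
  unfold hilbGe hilb
  rw [← Set.ncard_image_of_injective (s := {ξ | ξ ∈ {ξ | ξ ∈ D ∧ k ≤ ξ 0} ∧ _})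
    (f := fun ξ : Fin (N + 1) → ℕ => (Fin.cons (ξ 0 + 1) (Fin.tail ξ) : Fin (N + 1) → ℕ))]
  · congr 2
    ext ξ
    obtain ⟨a, ξ, rfl⟩ : ∃ (a : ℕ) (η : Fin N → ℕ), ξ = Fin.cons a η :=
      ⟨_, _, (Fin.cons_self_tail ξ).symm⟩
    constructor
    · rintro ⟨⟨h, hk⟩, hr⟩
      simp only [Fin.cons_zero] at hk
      obtain ⟨a, rfl⟩ : ∃ a', a = a' + 1 := ⟨a - 1, by omega⟩
      refine ⟨Fin.cons a ξ, ⟨⟨?_, ?_⟩, ?_⟩, by simp⟩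
      · rwa [hs a (by omega), ← hs (a + 1) (by omega)]
      · simp only [Fin.cons_zero]; omega
      · rw [← hr, mdeg_cons, mdeg_cons]
        push_cast
        rw [Pi.single_add]
        abel
    · rintro ⟨η, ⟨⟨h, hk⟩, hr⟩, he⟩
      obtain ⟨b, η, rfl⟩ : ∃ (a : ℕ) (η' : Fin N → ℕ), η = Fin.cons a η' :=
        ⟨_, _, (Fin.cons_self_tail η).symm⟩
      simp only [Fin.cons_zero, Fin.tail_cons] at he hk
      rw [← he]
      refine ⟨⟨?_, ?_⟩, ?_⟩
      · rwa [hs (b + 1) (by omega), ← hs b hk]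
      · simp only [Fin.cons_zero]; omega
      · rw [mdeg_cons] at hr ⊢
        push_cast
        rw [Pi.single_add, add_right_comm, hr]
        abel
  · intro ξ η h
    have h := Fin.cons_injective2 h
    rw [← Fin.cons_self_tail ξ, ← Fin.cons_self_tail η, h.2, Nat.succ_injective h.1]

lemma hilb_fin_mem_countSpan {N : ℕ} (c : Fin N → Fin p) (D : Set (Fin N → ℕ))
    (hD : IsLowerSet D) : hilb c D ∈ countSpan (∑ v, Pi.single (c v) 1) := by
  induction N with
  | zero =>
    by_cases h : (default : Fin 0 → ℕ) ∈ D
    · refine AddSubmonoid.subset_closure ⟨fun _ r => if r = 0 then 1 else 0,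
        fun j => by simpa using isCount_zero_indicator, ?_⟩
      funext r
      by_cases hr : r = 0
      · have : {ξ | ξ ∈ D ∧ mdeg c ξ = r} = {default} := by
          ext ξ
          rw [Set.mem_singleton_iff, eq_iff_true_of_subsingleton, iff_true]
          exact ⟨Subsingleton.elim default ξ ▸ h, by simp [hr, mdeg]⟩
        rw [hilb, this, Set.ncard_singleton]
        simp [hr]
      · have : {ξ | ξ ∈ D ∧ mdeg c ξ = r} = ∅ := by
          ext ξ
          simp [Ne.symm hr, mdeg]
        obtain ⟨j, hj⟩ := Function.ne_iff.1 hr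
        rw [hilb, this, prod_eq_zero (mem_univ j) (by simpa using hj)]
        simp only [Set.ncard_empty, Nat.cast_zero]
    · have : hilb c D = 0 := by
        funext r
        have : {ξ | ξ ∈ D ∧ mdeg c ξ = r} = ∅ := by
          rw [Set.eq_empty_iff_forall_notMem]
          exact fun ξ hξ => h (Subsingleton.elim ξ default ▸ hξ.1)
        rw [hilb, this, Set.ncard_empty]
        rfl
      rw [this]
      exact zero_mem _
  | succ N ih =>
    rw [Fin.sum_univ_succ]
    let S : ℕ → Set (Fin N → ℕ) := fun k => {ξ | (Fin.cons k ξ : Fin (N + 1) → ℕ) ∈ D}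
    have hcons : ∀ {k l : ℕ} {ξ η : Fin N → ℕ}, k ≤ l → ξ ≤ η →
        (Fin.cons k ξ : Fin (N + 1) → ℕ) ≤ Fin.cons l η := fun hk h => by
      rw [Fin.cons_le_cons]; exact ⟨hk, h⟩
    have hS : ∀ k, IsLowerSet (S k) := fun k ξ η h hξ => hD (hcons le_rfl h) hξ
    obtain ⟨k₀, hk₀⟩ := exists_stable_of_antitone S hS fun k l hkl ξ hξ => hD (hcons hkl le_rfl) hξ
    have hstep := fun k => ih (fun v => c v.succ) (S k) (hS k)
    -- From `k₀` on all slices coincide, so the tail satisfies a difference equation whose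
    -- inhomogeneous part is the Hilbert function of one slice.
    have htop : hilbGe c D k₀ ∈ countSpan (Pi.single (c 0) 1 + ∑ v : Fin N, Pi.single (c v.succ) 1) := by
      refine countSpan_of_difference (hstep k₀) (c 0) k₀ (fun r => ?_) (fun r hr => ?_)
      · rw [← hilbGe_succ_of_stable c D k₀, hilbGe_eq_add]
        intro l hl ξ
        exact Set.ext_iff.1 (hk₀ l hl) ξ
      · have : {ξ | ξ ∈ {ξ | ξ ∈ D ∧ k₀ ≤ ξ 0} ∧ mdeg c ξ = r} = ∅ := by
          rw [Set.eq_empty_iff_forall_notMem]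
          rintro ξ ⟨-, h⟩
          have := le_mdeg c ξ 0
          rw [h] at this
          omega
        rw [hilbGe, hilb, this, Set.ncard_empty, Nat.cast_zero]
    -- The finitely many slices below `k₀` are added one at a time, downwards.
    have hall : ∀ i, i ≤ k₀ → hilbGe c D (k₀ - i) ∈
        countSpan (Pi.single (c 0) 1 + ∑ v : Fin N, Pi.single (c v.succ) 1) := by
      intro i
      induction i with
      | zero => exact fun _ => htop
      | succ i ihi =>
        intro hi
        have h1 := ihi (by omega)
        have h2 : hilbGe c D (k₀ - (i + 1)) = hilbGe c D (k₀ - i) +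
            fun r => hilb (fun v => c v.succ) (S (k₀ - (i + 1)))
              (r - Pi.single (c 0) ((k₀ - (i + 1) : ℕ) : ℤ)) := by
          funext r
          rw [hilbGe_eq_add, show k₀ - (i + 1) + 1 = k₀ - i by omega]
          rfl
        rw [h2]
        exact add_mem h1 (countSpan_shift (hstep _) _ _)
    have h := hall k₀ le_rfl
    rw [Nat.sub_self] at h
    convert h using 1
    funext r
    simp [hilbGe]

/-- The Hilbert function of a lower set of monomials. -/
theorem hilb_mem_countSpan {ι : Type*} [Fintype ι] (c : ι → Fin p) (D : Set (ι → ℕ))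
    (hD : IsLowerSet D) : hilb c D ∈ countSpan (∑ v, Pi.single (c v) 1) := by
  let e := Fintype.equivFin ι
  have h := hilb_fin_mem_countSpan (fun v => c (e.symm v)) {ξ | (fun v => ξ (e v)) ∈ D}
    fun ξ η h hξ => hD (fun v => h (e v)) hξ
  have h1 : ∑ v, Pi.single (M := fun _ => ℕ) (c (e.symm v)) 1 = ∑ v, Pi.single (c v) 1 :=
    e.symm.sum_comp fun v => Pi.single (M := fun _ => ℕ) (c v) 1
  rw [h1] at h
  convert h using 1
  funext r
  unfold hilb
  rw [← Set.ncard_image_of_injective (f := fun ξ : ι → ℕ => fun v => ξ (e.symm v))]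
  · congr 2
    ext ξ
    constructor
    · rintro ⟨η, ⟨h, hr⟩, rfl⟩
      refine ⟨by simpa using h, ?_⟩
      rw [← hr]
      exact e.symm.sum_comp fun v => Pi.single (M := fun _ => ℤ) (c v) (η v : ℤ)
    · rintro ⟨h, hr⟩
      refine ⟨fun v => ξ (e v), ⟨h, ?_⟩, by simp⟩
      rw [← hr]
      have := e.symm.sum_comp fun v => Pi.single (M := fun _ => ℤ) (c v) (ξ (e v) : ℤ)
      rw [mdeg, ← this]
      simp [mdeg]
  · intro ξ η h
    funext v
    simpa using congrFun h (e v)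

/-! ### The binomial basis -/

/-- The coefficient of `φ` at the exponent `k`, given as a plain function. -/
def coeffAt (φ : MvPolynomial (Fin p) ℚ) (k : Fin p → ℕ) : ℚ :=
  φ.coeff (Finsupp.equivFunOnFinite.symm k)

lemma coeffAt_coe (φ : MvPolynomial (Fin p) ℚ) (k : Fin p →₀ ℕ) : coeffAt φ k = φ.coeff k := by
  unfold coeffAt
  congr 1
  ext; rfl

lemma eval_binom (r : Fin p → ℤ) (j : Fin p) (k : ℕ) :
    MvPolynomial.eval (fun j => (r j : ℚ)) (binom j k) = binomFun k (r j) := by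
  simp [binom, binomFun]

/-- The product `∏ j, (t_j + k_j choose k_j)`. -/
def binomProd (k : Fin p → ℕ) : MvPolynomial (Fin p) ℚ := ∏ j, binom j (k j)

lemma degreeOf_binomProd_le (k : Fin p → ℕ) (i : Fin p) : (binomProd k).degreeOf i ≤ k i := by
  have hb : ∀ j, (binom j (k j)).degreeOf i ≤ if i = j then k j else 0 := by
    intro j
    refine (MvPolynomial.degreeOf_C_mul_le _ _ _).trans
      ((MvPolynomial.degreeOf_prod_le _ _ _).trans ?_)
    have : ∀ l ∈ range (k j), (MvPolynomial.X j + MvPolynomial.C ((l : ℚ) + 1) :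
        MvPolynomial (Fin p) ℚ).degreeOf i ≤ if i = j then 1 else 0 := fun l _ => by
      refine (MvPolynomial.degreeOf_add_le _ _ _).trans ?_
      rw [MvPolynomial.degreeOf_C, MvPolynomial.degreeOf_X]
      simp
    refine (sum_le_sum this).trans ?_
    split_ifs <;> simp
  exact ((MvPolynomial.degreeOf_prod_le _ _ _).trans (sum_le_sum fun j _ => hb j)).trans (by simp)

lemma coeffAt_binomProd_eq_zero {k l : Fin p → ℕ} (h : ¬ l ≤ k) :
    coeffAt (binomProd k) l = 0 := by
  by_contra hne
  refine h fun i => ?_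
  exact (MvPolynomial.monomial_le_degreeOf i (MvPolynomial.mem_support_iff.2 hne)).trans
    (degreeOf_binomProd_le k i)

/-- The leading coefficient of `binomProd k`. -/
def binomLead (k : Fin p → ℕ) : ℚ := ∏ j, ((k j).factorial : ℚ)⁻¹

lemma binomLead_ne_zero (k : Fin p → ℕ) : binomLead k ≠ 0 :=
  prod_ne_zero_iff.2 fun j _ => inv_ne_zero (by exact_mod_cast (k j).factorial_ne_zero)

lemma coeffAt_binomProd_self (k : Fin p → ℕ) : coeffAt (binomProd k) k = binomLead k := by
  let Q : MvPolynomial (Fin p) ℚ :=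
    ∏ j, ∏ l ∈ range (k j), (MvPolynomial.X j + MvPolynomial.C ((l : ℚ) + 1))
  have hQ : binomProd k = MvPolynomial.C (binomLead k) * Q := by
    simp only [binomProd, binom, binomLead, Q, prod_mul_distrib, map_prod]
  -- The factors `t_j + const` are monic, so their product is monic and the degrees add up to `k`.
  let m : MonomialOrder (Fin p) := MonomialOrder.lex
  have hm : m.Monic Q :=
    MonomialOrder.Monic.prod fun j _ => MonomialOrder.Monic.prod fun l _ => m.monic_X_add_C j _
  have hne : ∀ (j : Fin p) (q : ℚ), (MvPolynomial.X j + MvPolynomial.C q) ≠ 0 := fun j q =>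
    (m.monic_X_add_C j q).ne_zero
  have hd : m.degree Q = Finsupp.equivFunOnFinite.symm k := by
    rw [MonomialOrder.degree_prod fun j _ => prod_ne_zero_iff.2 fun l _ => hne _ _]
    have : ∀ j : Fin p, m.degree (∏ l ∈ range (k j),
        (MvPolynomial.X j + MvPolynomial.C ((l : ℚ) + 1))) = Finsupp.single j (k j) := fun j => by
      rw [MonomialOrder.degree_prod fun l _ => hne _ _]
      rw [sum_congr rfl fun l _ => m.degree_X_add_C j _]
      simp
    rw [sum_congr rfl fun j _ => this j]
    ext i
    simp [Finsupp.finsetSum_apply, Finsupp.single_apply]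
  have h1 : Q.coeff (Finsupp.equivFunOnFinite.symm k) = 1 := by
    rw [← hd]; exact hm
  rw [coeffAt, hQ, MvPolynomial.coeff_C_mul, h1, mul_one]

/-! ### Triangular change of basis between binomial products and monomials. -/

section Expansion

variable {n : ℕ} {c : Fin n → Fin p} {φ : MvPolynomial (Fin p) ℚ} {a : (Fin p → ℕ) →₀ ℤ}

lemma HasExpansion.coeffAt_eq (h : HasExpansion c φ a) (k : Fin p → ℕ) :
    coeffAt φ k = ∑ l ∈ a.support, (a l : ℚ) * coeffAt (binomProd l) k := by
  rw [h.2]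
  simp only [coeffAt, MvPolynomial.coeff_sum, MvPolynomial.coeff_C_mul, binomProd]

lemma HasExpansion.coeffAt_eq_mul (h : HasExpansion c φ a) {k : Fin p → ℕ}
    (hk : ∀ l, k < l → a l = 0) : coeffAt φ k = a k * binomLead k := by
  rw [h.coeffAt_eq, sum_eq_single k, coeffAt_binomProd_self]
  · intro l hl hne
    rw [coeffAt_binomProd_eq_zero, mul_zero]
    intro hle
    exact Finsupp.mem_support_iff.1 hl (hk l (hle.lt_of_ne hne.symm))
  · intro hk
    simp [Finsupp.notMem_support_iff.1 hk]

/-- `binomProd k` involves only exponents below `k`, which gives one direction. For the other, a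
maximal element of the support above a bad exponent stays in `U`, and its monomial coefficient is `a
k` times a nonzero number. -/
lemma HasExpansion.forall_eq_zero_iff (h : HasExpansion c φ a) {U : Set (Fin p → ℕ)}
    (hU : IsUpperSet U) : (∀ l ∈ U, a l = 0) ↔ ∀ l ∈ U, coeffAt φ l = 0 := by
  constructor
  · intro h0 l hl
    rw [h.coeffAt_eq]
    refine sum_eq_zero fun k hk => ?_
    rw [coeffAt_binomProd_eq_zero, mul_zero]
    exact fun hle => Finsupp.mem_support_iff.1 hk (h0 k (hU hle hl))
  · intro h0
    by_contra! hcon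
    obtain ⟨l, hl, hne⟩ := hcon
    obtain ⟨k, hlk, hk⟩ := a.support.exists_le_maximal (Finsupp.mem_support_iff.2 hne)
    have h1 : coeffAt φ k = a k * binomLead k := h.coeffAt_eq_mul fun l' hl' => by
      by_contra hne'
      exact hk.not_gt (Finsupp.mem_support_iff.2 hne') hl'
    rw [h0 k (hU hlk hl)] at h1
    have h2 : (a k : ℚ) ≠ 0 := Int.cast_ne_zero.2 (Finsupp.mem_support_iff.1 hk.prop)
    exact mul_ne_zero h2 (binomLead_ne_zero k) h1.symm

lemma HasExpansion.coeffAt_eq_mul' (h : HasExpansion c φ a) {k : Fin p → ℕ}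
    (hk : ∀ l, k < l → coeffAt φ l = 0) : coeffAt φ k = a k * binomLead k :=
  h.coeffAt_eq_mul ((h.forall_eq_zero_iff (isUpperSet_Ioi k)).2 hk)

lemma HasExpansion.apply_eq {n' : ℕ} {c' : Fin n' → Fin p} {φ' : MvPolynomial (Fin p) ℚ}
    {b : (Fin p → ℕ) →₀ ℤ} (h : HasExpansion c φ a) (h' : HasExpansion c' φ' b) {k : Fin p → ℕ}
    (hk : ∀ l, k < l → coeffAt φ l = 0) (hk' : ∀ l, k < l → coeffAt φ' l = 0)
    (he : coeffAt φ k = coeffAt φ' k) : a k = b k := by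
  rw [h.coeffAt_eq_mul' hk, h'.coeffAt_eq_mul' hk'] at he
  exact_mod_cast mul_right_cancel₀ (binomLead_ne_zero k) he

lemma HasExpansion.unique {b : (Fin p → ℕ) →₀ ℤ} (ha : HasExpansion c φ a)
    (hb : HasExpansion c φ b) : a = b := by
  have hs : HasExpansion c 0 (a - b) := by
    refine ⟨fun k hk => ?_, ?_⟩
    · rcases mem_union.1 (Finsupp.support_sub hk) with h | h
      exacts [ha.1 k h, hb.1 k h]
    · have h1 : ∀ f : (Fin p → ℕ) →₀ ℤ, f.support ⊆ a.support ∪ b.support →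
          ∑ k ∈ f.support, MvPolynomial.C (f k : ℚ) * ∏ j, binom j (k j) =
          ∑ k ∈ a.support ∪ b.support, MvPolynomial.C (f k : ℚ) * ∏ j, binom j (k j) :=
        fun f hf => sum_subset hf fun k _ hk => by simp [Finsupp.notMem_support_iff.1 hk]
      have h2 := ha.2.symm.trans hb.2
      rw [h1 a subset_union_left, h1 b subset_union_right] at h2
      rw [h1 _ Finsupp.support_sub, ← sub_eq_zero.2 h2, ← sum_sub_distrib]
      refine sum_congr rfl fun k _ => ?_
      simp [sub_mul]
  have h0 := (hs.forall_eq_zero_iff isUpperSet_univ).2 fun l _ => by simp [coeffAt]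
  ext k
  simpa [sub_eq_zero] using h0 k trivial

end Expansion

/-! ### From numerical functions to polynomials -/

/-- `H` agrees for all large `r` with an integer combination of the products `binomProd k`,
`k_j < κ_j`. -/
def EventuallyExpands (κ : Fin p → ℕ) (H : (Fin p → ℤ) → ℤ) : Prop :=
  ∃ a : (Fin p → ℕ) →₀ ℤ, (∀ k ∈ a.support, ∀ j, k j < κ j) ∧ ∃ s : Fin p → ℤ, ∀ r, s ≤ r →
    (H r : ℚ) = a.sum fun k z => (z : ℚ) * ∏ j, binomFun (k j) (r j)

lemma eventuallyExpands_of_mem_countSpan {κ : Fin p → ℕ} {H : (Fin p → ℤ) → ℤ}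
    (hH : H ∈ countSpan κ) : EventuallyExpands κ H := by
  induction hH using AddSubmonoid.closure_induction with
  | mem H h =>
    obtain ⟨g, hg, rfl⟩ := h
    choose q hq s hs using fun j => (hg j).2
    choose z hz using fun j => (Submodule.mem_span_range_iff_exists_fun ℤ).1 (hq j)
    have hz' : ∀ j r, q j r = ∑ i ∈ range (κ j),
        ((if h : i < κ j then z j ⟨i, h⟩ else 0 : ℤ) : ℚ) * binomFun i r := by
      intro j r
      rw [← hz j, Finset.sum_range]
      simp [Finset.sum_apply]
    let A : (Fin p → ℕ) → ℤ := fun k => ∏ j, (if h : k j < κ j then z j ⟨k j, h⟩ else 0 : ℤ)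
    let T : Finset (Fin p → ℕ) := Fintype.piFinset fun j => range (κ j)
    refine ⟨Finsupp.onFinset T A fun k hk => ?_, fun k hk j => ?_, s, fun r hr => ?_⟩
    · rw [Fintype.mem_piFinset]
      intro j
      by_contra hj
      exact hk (prod_eq_zero (mem_univ j) (dif_neg (by simpa using hj)))
    · have := Finsupp.support_onFinset_subset hk
      exact mem_range.1 (Fintype.mem_piFinset.1 this j)
    · rw [Finsupp.sum_of_support_subset _ Finsupp.support_onFinset_subset _ (by simp)]
      push_cast
      -- Expanding the product of one-variable sums gives a sum over the box `T`.
      rw [prod_congr rfl fun j _ => (hs j (r j) (hr j)).trans (hz' j (r j)), prod_univ_sum]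
      refine sum_congr rfl fun k _ => ?_
      rw [prod_mul_distrib, ← Int.cast_prod]
  | zero => exact ⟨0, by simp, 0, by simp⟩
  | add H H' _ _ h h' =>
    obtain ⟨a, ha, s, hs⟩ := h
    obtain ⟨b, hb, s', hs'⟩ := h'
    refine ⟨a + b, fun k hk => ?_, s ⊔ s', fun r hr => ?_⟩
    · rcases mem_union.1 (Finsupp.support_add hk) with h | h
      exacts [ha k h, hb k h]
    · rw [Finsupp.sum_add_index' (by simp) (fun k x y => by push_cast; ring), Pi.add_apply,
        ← hs r (le_sup_left.trans hr), ← hs' r (le_sup_right.trans hr)]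
      push_cast; rfl

/-! ### Comparison of leading terms -/

/-- Two polynomials agreeing at all large integer points are equal. -/
lemma eq_of_eval_eq_of_le {φ φ' : MvPolynomial (Fin p) ℚ} (s : Fin p → ℤ)
    (h : ∀ r : Fin p → ℤ, s ≤ r → MvPolynomial.eval (fun j => (r j : ℚ)) φ =
      MvPolynomial.eval (fun j => (r j : ℚ)) φ') : φ = φ' := by
  refine MvPolynomial.funext_set (fun j => (fun z : ℤ => (z : ℚ)) '' Set.Ici (s j))
    (fun j => (Set.Ici_infinite _).image Int.cast_injective.injOn) fun x hx => ?_
  choose r hr hrx using fun j => hx j trivial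
  rw [← show (fun j => (r j : ℚ)) = x from funext hrx]
  exact h r hr

/-- The weight of the exponent `k`. -/
def wt (w k : Fin p → ℕ) : ℕ := ∑ j, w j * k j

/-- The part of weight `D` of `φ`. -/
def weightPart (w : Fin p → ℕ) (D : ℕ) (φ : MvPolynomial (Fin p) ℚ) : MvPolynomial (Fin p) ℚ :=
  ∑ k ∈ φ.support.filter (fun k : Fin p →₀ ℕ => wt w k = D), MvPolynomial.monomial k (φ.coeff k)

lemma coeff_weightPart {w : Fin p → ℕ} {D : ℕ} {φ : MvPolynomial (Fin p) ℚ} {k : Fin p →₀ ℕ}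
    (hk : wt w k = D) : (weightPart w D φ).coeff k = φ.coeff k := by
  rw [weightPart, MvPolynomial.coeff_sum]
  simp only [MvPolynomial.coeff_monomial]
  rw [sum_ite_eq' (φ.support.filter _) k]
  simp only [mem_filter, hk, and_true, MvPolynomial.mem_support_iff, ne_eq, ite_not]
  split_ifs with h
  · exact h.symm
  · rfl

open Filter Topology in
lemma tendsto_eval_div {w : Fin p → ℕ} (hw : ∀ j, 0 < w j) {D : ℕ} {φ : MvPolynomial (Fin p) ℚ}
    (hφ : ∀ k ∈ φ.support, wt w k ≤ D) (ρ q : Fin p → ℚ) :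
    Tendsto (fun N : ℕ => MvPolynomial.eval (fun j => ρ j * (N : ℚ) ^ w j + q j) φ / (N : ℚ) ^ D)
      atTop (𝓝 (MvPolynomial.eval ρ (weightPart w D φ))) := by
  have hinv : ∀ m : ℕ, 0 < m → Tendsto (fun N : ℕ => ((N : ℚ) ^ m)⁻¹) atTop (𝓝 0) := fun m hm =>
    (tendsto_inv_atTop_zero.comp (tendsto_pow_atTop hm.ne')).comp tendsto_natCast_atTop_atTop
  -- Taking `N ^ w j` out of each factor leaves `ρ j` plus a term tending to `0`, so the shift `q`
  -- disappears, as do monomials of weight below `D`.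
  have hterm : ∀ k ∈ φ.support, Tendsto (fun N : ℕ =>
      φ.coeff k * (∏ j, (ρ j + q j * ((N : ℚ) ^ w j)⁻¹) ^ k j) * ((N : ℚ) ^ (D - wt w k))⁻¹)
      atTop (𝓝 (if wt w k = D then φ.coeff k * ∏ j, ρ j ^ k j else 0)) := by
    intro k hk
    have h1 : Tendsto (fun N : ℕ => φ.coeff k * ∏ j, (ρ j + q j * ((N : ℚ) ^ w j)⁻¹) ^ k j)
        atTop (𝓝 (φ.coeff k * ∏ j, ρ j ^ k j)) := by
      refine Tendsto.const_mul _ (tendsto_finsetProd _ fun j _ => Tendsto.pow ?_ _)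
      simpa using ((hinv (w j) (hw j)).const_mul (q j)).const_add (ρ j)
    split_ifs with h
    · simpa [h] using h1
    · simpa using h1.mul (hinv (D - wt w k) (by have := hφ k hk; omega))
  have hsum := tendsto_finsetSum φ.support hterm
  have hlim : MvPolynomial.eval ρ (weightPart w D φ) =
      ∑ k ∈ φ.support, if wt w k = D then φ.coeff k * ∏ j, ρ j ^ k j else 0 := by
    rw [weightPart, map_sum, sum_filter]
    refine sum_congr rfl fun k _ => ?_
    rw [MvPolynomial.eval_monomial, Finsupp.prod_fintype _ _ (by simp)]
  rw [hlim]
  refine hsum.congr' ?_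
  filter_upwards [eventually_gt_atTop 0] with N hN
  have hN' : (N : ℚ) ≠ 0 := by positivity
  rw [MvPolynomial.eval_eq', sum_div]
  refine sum_congr rfl fun k hk => ?_
  have h1 : ∏ j, (ρ j * (N : ℚ) ^ w j + q j) ^ k j =
      (∏ j, (ρ j + q j * ((N : ℚ) ^ w j)⁻¹) ^ k j) * (N : ℚ) ^ wt w k := by
    rw [wt, ← prod_pow_eq_pow_sum, ← prod_mul_distrib]
    refine prod_congr rfl fun j _ => ?_
    rw [pow_mul, ← mul_pow]
    congr 1
    field_simp
  have h2 : (N : ℚ) ^ D = (N : ℚ) ^ (D - wt w k) * (N : ℚ) ^ wt w k := by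
    rw [← pow_add, Nat.sub_add_cancel (hφ k hk)]
  rw [h1, h2]
  field_simp

/-- `φ(r) ≤ φ'(r + q)` for all large `r`. -/
def EventuallyLE (φ φ' : MvPolynomial (Fin p) ℚ) : Prop :=
  ∃ q s : Fin p → ℤ, ∀ r : Fin p → ℤ, s ≤ r → MvPolynomial.eval (fun j => (r j : ℚ)) φ ≤
    MvPolynomial.eval (fun j => ((r j + q j : ℤ) : ℚ)) φ'

section Compare

variable {φ φ' : MvPolynomial (Fin p) ℚ} {w : Fin p → ℕ} {D : ℕ}

open Filter in
lemma EventuallyLE.eval_weightPart_le (h : EventuallyLE φ φ') (hw : ∀ j, 0 < w j)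
    (hφ : ∀ k ∈ φ.support, wt w k ≤ D) (hφ' : ∀ k ∈ φ'.support, wt w k ≤ D)
    (ρ : Fin p → ℤ) (hρ : ∀ j, 0 < ρ j) :
    MvPolynomial.eval (fun j => (ρ j : ℚ)) (weightPart w D φ) ≤
      MvPolynomial.eval (fun j => (ρ j : ℚ)) (weightPart w D φ') := by
  obtain ⟨q, s, h⟩ := h
  refine le_of_tendsto_of_tendsto (tendsto_eval_div hw hφ (fun j => (ρ j : ℚ)) 0)
    (tendsto_eval_div hw hφ' (fun j => (ρ j : ℚ)) (fun j => (q j : ℚ))) ?_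
  obtain ⟨N₀, hN₀⟩ : ∃ N₀ : ℕ, ∀ j, s j ≤ N₀ :=
    ⟨univ.sup fun j => (s j).toNat, fun j => (Int.self_le_toNat _).trans
      (by exact_mod_cast le_sup (f := fun j => (s j).toNat) (mem_univ j))⟩
  filter_upwards [eventually_ge_atTop (N₀ + 1)] with N hN
  have h1 := h (fun j => ρ j * (N : ℤ) ^ w j) fun j => by
    have h2 : (N : ℤ) ≤ (N : ℤ) ^ w j := le_self_pow₀ (by omega) (hw j).ne'
    have h3 : (N : ℤ) ^ w j ≤ ρ j * (N : ℤ) ^ w j := by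
      have := hρ j
      have h4 : (0 : ℤ) ≤ (N : ℤ) ^ w j := by positivity
      nlinarith
    have := hN₀ j
    change s j ≤ ρ j * (N : ℤ) ^ w j
    omega
  push_cast at h1
  simp only [Pi.zero_apply, add_zero]
  gcongr

lemma coeff_eq_of_wt_eq (h : EventuallyLE φ φ') (h' : EventuallyLE φ' φ) (hw : ∀ j, 0 < w j)
    (hφ : ∀ k ∈ φ.support, wt w k ≤ D) (hφ' : ∀ k ∈ φ'.support, wt w k ≤ D)
    (k : Fin p →₀ ℕ) (hk : wt w k = D) : φ.coeff k = φ'.coeff k := by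
  have : weightPart w D φ = weightPart w D φ' := eq_of_eval_eq_of_le 1 fun r hr =>
    have hr' : ∀ j, 0 < r j := fun j => Int.lt_of_lt_of_le Int.zero_lt_one (hr j)
    (h.eval_weightPart_le hw hφ hφ' r hr').antisymm (h'.eval_weightPart_le hw hφ' hφ r hr')
  rw [← coeff_weightPart hk, this, coeff_weightPart hk]

/-- If the top weight of `φ'` exceeded `D`, comparison at that weight would put a top exponent of
`φ'` into the support of `φ`. -/
lemma forall_wt_le_of_forall_wt_le (h : EventuallyLE φ φ') (h' : EventuallyLE φ' φ)
    (hw : ∀ j, 0 < w j) (hφ : ∀ k ∈ φ.support, wt w k ≤ D) : ∀ k ∈ φ'.support, wt w k ≤ D := by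
  intro k hk
  obtain ⟨l, hl, hmax⟩ := exists_max_image φ'.support (fun k => wt w k) ⟨k, hk⟩
  refine (hmax k hk).trans ?_
  by_contra! hlt
  have := coeff_eq_of_wt_eq h h' hw (fun k hk => (hφ k hk).trans hlt.le) hmax l rfl
  rw [MvPolynomial.mem_support_iff, ← this, ← MvPolynomial.mem_support_iff] at hl
  exact (hφ l hl).not_gt hlt

lemma coeff_eq_of_forall_wt_le (h : EventuallyLE φ φ') (h' : EventuallyLE φ' φ)
    (hw : ∀ j, 0 < w j) (hφ : ∀ k ∈ φ.support, wt w k ≤ D) (k : Fin p →₀ ℕ) (hk : wt w k = D) :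
    φ.coeff k = φ'.coeff k :=
  coeff_eq_of_wt_eq h h' hw hφ (forall_wt_le_of_forall_wt_le h h' hw hφ) k hk

lemma totalDegree_le_iff_wt : φ.totalDegree ≤ D ↔ ∀ k ∈ φ.support, wt 1 k ≤ D := by
  rw [MvPolynomial.totalDegree, Finset.sup_le_iff]
  simp [wt, Finsupp.sum_fintype]

lemma totalDegree_eq_of_eventuallyLE (h : EventuallyLE φ φ') (h' : EventuallyLE φ' φ) :
    φ.totalDegree = φ'.totalDegree :=
  le_antisymm
    (totalDegree_le_iff_wt.2 (forall_wt_le_of_forall_wt_le h' h (by simp)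
      (totalDegree_le_iff_wt.1 le_rfl)))
    (totalDegree_le_iff_wt.2 (forall_wt_le_of_forall_wt_le h h' (by simp)
      (totalDegree_le_iff_wt.1 le_rfl)))

lemma degreeOf_le_of_eventuallyLE (h : EventuallyLE φ φ') (h' : EventuallyLE φ' φ) (j : Fin p) :
    φ.degreeOf j ≤ φ'.degreeOf j := by
  rcases φ.support.eq_empty_or_nonempty with h0 | h0
  · rw [MvPolynomial.support_eq_empty.1 h0]
    simp
  -- `N` exceeds the total degree of every monomial of `φ`, so a higher power of `t_j` always wins
  -- in the weight `1 + N e_j`.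
  let N := φ.totalDegree + 1
  let w : Fin p → ℕ := 1 + Pi.single j N
  have hwt : ∀ k : Fin p →₀ ℕ, wt w k = wt 1 k + N * k j := fun k => by
    simp [wt, w, add_mul, sum_add_distrib, Pi.single_apply]
  obtain ⟨k, hk, hmax⟩ := exists_max_image φ.support (fun k => wt w k) h0
  have hk' : k ∈ φ'.support := by
    rw [MvPolynomial.mem_support_iff,
      ← coeff_eq_of_forall_wt_le h h' (fun i => by simp [w]) hmax k rfl]
    exact MvPolynomial.mem_support_iff.1 hk
  refine le_trans ?_ (MvPolynomial.monomial_le_degreeOf j hk')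
  rw [MvPolynomial.degreeOf_eq_sup]
  refine Finset.sup_le fun l hl => ?_
  by_contra! hlt
  have h1 := hmax l hl
  rw [hwt, hwt] at h1
  have h2 : wt 1 k ≤ φ.totalDegree := totalDegree_le_iff_wt.1 le_rfl k hk
  have h3 : N * (k j + 1) ≤ N * l j := Nat.mul_le_mul_left N hlt
  rw [mul_add, mul_one] at h3
  omega

end Compare

/-! ### Lexicographic orders -/

/-- The lexicographic order on bounded exponents is induced by a positive weight. -/
lemma exists_weight_of_lex (B p : ℕ) : ∃ w : Fin p → ℕ, (∀ j, 0 < w j) ∧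
    ∀ k l : Fin p → ℕ, (∀ j, k j ≤ B) → toLex k < toLex l → wt w k < wt w l := by
  induction p with
  | zero =>
    refine ⟨1, by simp, fun k l _ h => ?_⟩
    rw [Subsingleton.elim k l] at h
    exact absurd h (lt_irrefl _)
  | succ p ih =>
    obtain ⟨w, hw, hlt⟩ := ih
    -- `N` exceeds the weight of any tail bounded by `B`, so one unit in the first coordinate
    -- outweighs the whole tail of `k`.
    let N := ∑ j, w j * B + 1
    refine ⟨Fin.cons N w, fun j => ?_, fun k l hk h => ?_⟩
    · refine Fin.cases ?_ (fun j => ?_) j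
      · simp [N]
      · simpa using hw j
    · have h1 : ∀ k : Fin (p + 1) → ℕ, wt (Fin.cons N w : Fin (p + 1) → ℕ) k =
          N * k 0 + wt w (Fin.tail k) := fun k => by
        simp [wt, Fin.sum_univ_succ, Fin.tail]
      have h2 : toLex (Fin.cons (k 0) (Fin.tail k) : Fin (p + 1) → ℕ) <
          toLex (Fin.cons (l 0) (Fin.tail l) : Fin (p + 1) → ℕ) := by
        rwa [Fin.cons_self_tail, Fin.cons_self_tail]
      rw [h1, h1]
      rcases (Fin.pi_lex_lt_cons_cons (α := fun _ => ℕ) (· < ·)).1 h2 with h3 | ⟨h3, h4⟩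
      · have h5 : wt w (Fin.tail k) < N :=
          Nat.lt_succ_of_le (sum_le_sum fun j _ => Nat.mul_le_mul_left _ (hk j.succ))
        have h6 : N * (k 0 + 1) ≤ N * l 0 := Nat.mul_le_mul_left N h3
        rw [mul_add, mul_one] at h6
        omega
      · rw [h3]
        exact Nat.add_lt_add_left (hlt _ _ (fun j => hk j.succ) h4) _

lemma wt_comp_perm (w k : Fin p → ℕ) (σ : Equiv.Perm (Fin p)) :
    wt w (k ∘ σ) = wt (w ∘ σ.symm) k := by
  unfold wt
  rw [← Equiv.sum_comp σ (fun j => (w ∘ σ.symm) j * k j)]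
  simp

lemma isUpperSet_lex_lt (k : Fin p → ℕ) (σ : Equiv.Perm (Fin p)) :
    IsUpperSet {l : Fin p → ℕ | toLex (k ∘ σ) < toLex (l ∘ σ)} := fun _ _ h hl =>
  lt_of_lt_of_le hl (Pi.toLex_monotone fun j => h (σ j))

lemma coeffAt_eq_of_lex_le {φ φ' : MvPolynomial (Fin p) ℚ} (h : EventuallyLE φ φ')
    (h' : EventuallyLE φ' φ) {k : Fin p → ℕ} (σ : Equiv.Perm (Fin p))
    (hk : ∀ l, toLex (k ∘ σ) < toLex (l ∘ σ) → coeffAt φ l = 0) :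
    coeffAt φ k = coeffAt φ' k ∧ ∀ l, toLex (k ∘ σ) < toLex (l ∘ σ) → coeffAt φ' l = 0 := by
  -- The bound covers both `k` and the support of `φ`. The support of `φ'` needs none, since only
  -- the smaller exponent in a comparison must be bounded.
  obtain ⟨w, hw, hlt⟩ := exists_weight_of_lex (φ.totalDegree + ∑ j, k j) p
  have hφ : ∀ l ∈ φ.support, wt (w ∘ σ.symm) l ≤ wt (w ∘ σ.symm) k := fun l hl => by
    rw [← wt_comp_perm, ← wt_comp_perm]
    have h1 : toLex (l ∘ σ) ≤ toLex (k ∘ σ) := by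
      by_contra! h2
      exact MvPolynomial.mem_support_iff.1 hl ((coeffAt_coe φ l).symm.trans (hk l h2))
    rcases h1.eq_or_lt with h2 | h2
    · rw [toLex.injective h2]
    · refine (hlt _ _ (fun j => ?_) h2).le
      have h3 := totalDegree_le_iff_wt.1 le_rfl l hl
      have h4 : l (σ j) ≤ wt 1 l := by
        simpa [wt] using single_le_sum (f := fun i => l i) (fun _ _ => Nat.zero_le _)
          (mem_univ (σ j))
      simp only [Function.comp_apply]
      omega
  have hw' : ∀ j, 0 < (w ∘ σ.symm) j := fun j => hw _
  refine ⟨coeff_eq_of_forall_wt_le h h' hw' hφ (Finsupp.equivFunOnFinite.symm k) rfl, fun l hl => ?_⟩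
  by_contra hne
  have h1 := forall_wt_le_of_forall_wt_le h h' hw' hφ _ (MvPolynomial.mem_support_iff.2 hne)
  have h2 := hlt _ _ (fun j => ?_) hl
  · rw [wt_comp_perm, wt_comp_perm] at h2
    exact h1.not_gt h2
  · exact (single_le_sum (f := fun i => k i) (fun _ _ => Nat.zero_le _) (mem_univ (σ j))).trans
      (Nat.le_add_left _ _)

lemma mem_lexMaximal_iff {a : (Fin p → ℕ) →₀ ℤ} {k : Fin p → ℕ} :
    k ∈ lexMaximal (a.support : Set (Fin p → ℕ)) ↔ a k ≠ 0 ∧ ∃ σ : Equiv.Perm (Fin p),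
      ∀ l, toLex (k ∘ σ) < toLex (l ∘ σ) → a l = 0 := by
  simp only [lexMaximal, Set.mem_ofPred_eq, mem_coe, Finsupp.mem_support_iff]
  refine and_congr_right fun _ => exists_congr fun σ => forall_congr' fun l => ?_
  rw [← not_lt, not_imp_comm, not_not]
  rfl

/-! ### Transfer of the comparison to the binomial coefficients. -/

section Invariants

variable {n n' : ℕ} {c : Fin n → Fin p} {c' : Fin n' → Fin p} {φ φ' : MvPolynomial (Fin p) ℚ}
  {a b : (Fin p → ℕ) →₀ ℤ}

lemma lex_lt_of_lt {k l : Fin p → ℕ} (σ : Equiv.Perm (Fin p)) (h : k < l) :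
    toLex (k ∘ σ) < toLex (l ∘ σ) := by
  refine (Pi.toLex_monotone fun j => h.le (σ j)).lt_of_ne fun he => h.ne ?_
  have := toLex.injective he
  exact σ.surjective.injective_comp_right this

/-- Lexicographic maximality of `k` says that `a` vanishes on an upper set; this translates to
monomial coefficients, where the weight comparison applies, and back. -/
lemma lexMaximal_apply_eq (h : EventuallyLE φ φ') (h' : EventuallyLE φ' φ)
    (ha : HasExpansion c φ a) (hb : HasExpansion c' φ' b) {k : Fin p → ℕ}
    (hk : k ∈ lexMaximal (a.support : Set (Fin p → ℕ))) :
    a k = b k ∧ k ∈ lexMaximal (b.support : Set (Fin p → ℕ)) := by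
  rw [mem_lexMaximal_iff] at hk ⊢
  obtain ⟨hne, σ, hσ⟩ := hk
  have h1 := (ha.forall_eq_zero_iff (isUpperSet_lex_lt k σ)).1 hσ
  obtain ⟨h2, h3⟩ := coeffAt_eq_of_lex_le h h' σ h1
  have h4 : a k = b k := ha.apply_eq hb (fun l hl => h1 l (lex_lt_of_lt σ hl))
    (fun l hl => h3 l (lex_lt_of_lt σ hl)) h2
  exact ⟨h4, h4 ▸ hne, σ, (hb.forall_eq_zero_iff (isUpperSet_lex_lt k σ)).2 h3⟩

lemma coeffAt_eq_zero_of_degree_lt {k : Fin p → ℕ} (hk : φ.totalDegree < ∑ j, k j) :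
    coeffAt φ k = 0 := by
  by_contra hne
  have := totalDegree_le_iff_wt.1 le_rfl _ (MvPolynomial.mem_support_iff.2 hne)
  simp only [wt, Pi.one_apply, one_mul] at this
  exact this.not_gt hk

lemma coeff_eq_of_sum_eq_totalDegree (h : EventuallyLE φ φ') (h' : EventuallyLE φ' φ)
    (k : Fin p →₀ ℕ) (hk : ∑ j, k j = φ.totalDegree) : φ.coeff k = φ'.coeff k :=
  coeff_eq_of_forall_wt_le h h' (w := 1) (by simp) (totalDegree_le_iff_wt.1 le_rfl) k
    (by simpa [wt] using hk)

lemma apply_eq_of_sum_eq_totalDegree (h : EventuallyLE φ φ') (h' : EventuallyLE φ' φ)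
    (ha : HasExpansion c φ a) (hb : HasExpansion c' φ' b) (k : Fin p → ℕ)
    (hk : ∑ j, k j = φ.totalDegree) : a k = b k := by
  have hlt : ∀ l, k < l → φ.totalDegree < ∑ j, l j := fun l hl => by
    rw [← hk]
    obtain ⟨hle, j, hj⟩ := Pi.lt_def.1 hl
    exact sum_lt_sum (fun i _ => hle i) ⟨j, mem_univ j, hj⟩
  refine ha.apply_eq hb (fun l hl => coeffAt_eq_zero_of_degree_lt (hlt l hl))
    (fun l hl => coeffAt_eq_zero_of_degree_lt ?_)
    (coeff_eq_of_sum_eq_totalDegree h h' _ hk)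
  rw [← totalDegree_eq_of_eventuallyLE h h']
  exact hlt l hl

/-- If all exponents of both polynomials are at most `k`, then the coefficients at `k` agree. -/
lemma apply_eq_of_forall_le (h : EventuallyLE φ φ') (h' : EventuallyLE φ' φ)
    (ha : HasExpansion c φ a) (hb : HasExpansion c' φ' b) {k : Fin p → ℕ}
    (hk : ∀ l, coeffAt φ l ≠ 0 → l ≤ k) (hk' : ∀ l, coeffAt φ' l ≠ 0 → l ≤ k) : a k = b k := by
  refine ha.apply_eq hb (fun l hl => ?_) (fun l hl => ?_) ?_
  · by_contra hne
    exact (hk l hne).not_gt hl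
  · by_contra hne
    exact (hk' l hne).not_gt hl
  -- All exponents of `φ` are at most `k`, so `k` has the largest possible weight for `w = 1`.
  · refine coeff_eq_of_forall_wt_le h h' (w := 1) (by simp) (fun l hl => ?_)
      (Finsupp.equivFunOnFinite.symm k) rfl
    have := hk l (by rw [coeffAt_coe]; exact MvPolynomial.mem_support_iff.1 hl)
    exact sum_le_sum fun j _ => Nat.mul_le_mul_left _ (this j)

lemma HasExpansion.le_of_coeffAt_ne_zero (ha : HasExpansion c φ a) (l : Fin p → ℕ)
    (hl : coeffAt φ l ≠ 0) : l ≤ fun j => 2 * blockSize c j := by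
  by_contra hle
  refine hl ((ha.forall_eq_zero_iff (isLowerSet_Iic fun j => 2 * blockSize c j).compl).1 ?_ l hle)
  intro k hk
  by_contra hne
  exact hk fun j => ha.1 k (Finsupp.mem_support_iff.2 hne) j

lemma le_degreeOf_of_coeffAt_ne_zero (l : Fin p → ℕ) (hl : coeffAt φ l ≠ 0) :
    l ≤ fun j => φ.degreeOf j :=
  fun j => MvPolynomial.monomial_le_degreeOf j (MvPolynomial.mem_support_iff.2 hl)

end Invariants

/-! ### Multiplication of monomials by generators -/

section ListProd

variable {A : Type*} [Semiring A]

lemma mul_prod_ofFn_pow {n : ℕ} (g : Fin n → A) (hg : ∀ i j, g i * g j = g j * g i)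
    (α : Fin n → ℕ) (i : Fin n) :
    g i * (List.ofFn fun j => g j ^ α j).prod =
      (List.ofFn fun j => g j ^ (α + Pi.single i 1 : Fin n → ℕ) j).prod := by
  induction n with
  | zero => exact i.elim0
  | succ n ih =>
    simp only [List.ofFn_succ, List.prod_cons]
    refine Fin.cases ?_ (fun i => ?_) i
    · simp [← mul_assoc, pow_succ']
    · have h := ih (fun j => g j.succ) (fun _ _ => hg _ _) (fun j => α j.succ) i
      have h0 : g i.succ * g 0 ^ α 0 = g 0 ^ α 0 * g i.succ :=
        (Commute.pow_right (hg i.succ 0) (α 0)).eq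
      rw [← mul_assoc, h0, mul_assoc, h]
      simp [Pi.single_apply, Fin.succ_inj, (Fin.succ_ne_zero i).symm]

lemma commute_prod_ofFn_pow {n : ℕ} (g : Fin n → A) (D : A) (hD : ∀ j, D * g j = g j * D)
    (α : Fin n → ℕ) :
    D * (List.ofFn fun j => g j ^ α j).prod = (List.ofFn fun j => g j ^ α j).prod * D := by
  induction n with
  | zero => simp
  | succ n ih =>
    simp only [List.ofFn_succ, List.prod_cons]
    rw [← mul_assoc, (Commute.pow_right (hD 0) (α 0)).eq, mul_assoc, mul_assoc,
      ih (fun j => g j.succ) (fun j => hD _) (fun j => α j.succ)]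

lemma mul_pow_of_mul_eq_add_one {D g : A} (h : D * g = g * D + 1) (a : ℕ) :
    D * g ^ a = g ^ a * D + a • g ^ (a - 1) := by
  induction a with
  | zero => simp
  | succ a ih =>
    rw [pow_succ, ← mul_assoc, ih, add_mul, mul_assoc, h, mul_add, mul_one, ← mul_assoc,
      add_assoc, Nat.add_sub_cancel]
    congr 1
    cases a with
    | zero => simp
    | succ a =>
      rw [Nat.add_sub_cancel, smul_mul_assoc, ← pow_succ, succ_nsmul _ (a + 1), add_comm]

/-- Leibniz rule. Truncated subtraction is harmless: when `α i = 0` the correction has coefficient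
`0`. -/
lemma derivation_prod_ofFn_pow {n : ℕ} (g : Fin n → A) (D : A) (i : Fin n)
    (hD : ∀ j, i ≠ j → D * g j = g j * D) (hi : D * g i = g i * D + 1) (α : Fin n → ℕ) :
    D * (List.ofFn fun j => g j ^ α j).prod = (List.ofFn fun j => g j ^ α j).prod * D +
      α i • (List.ofFn fun j => g j ^ (α - Pi.single i 1 : Fin n → ℕ) j).prod := by
  induction n with
  | zero => exact i.elim0
  | succ n ih =>
    simp only [List.ofFn_succ, List.prod_cons]
    revert hD hi
    refine Fin.cases ?_ (fun i => ?_) i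
    · intro hD hi
      have h := commute_prod_ofFn_pow (fun j => g j.succ) D
        (fun j => hD _ (Fin.succ_ne_zero j).symm) (fun j => α j.succ)
      rw [← mul_assoc, mul_pow_of_mul_eq_add_one hi, add_mul, mul_assoc, h, ← mul_assoc,
        smul_mul_assoc]
      simp
    · intro hD hi
      have h := ih (fun j => g j.succ) i (fun j hj => hD _ (by simpa using hj)) hi
        (fun j => α j.succ)
      rw [← mul_assoc, (Commute.pow_right (hD 0 (Fin.succ_ne_zero i)) (α 0)).eq, mul_assoc, h,
        mul_add, ← mul_assoc, mul_smul_comm]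
      simp [Pi.single_apply, Fin.succ_inj, (Fin.succ_ne_zero i).symm]

end ListProd

section Weyl

variable (K : Type*) [Field K] {n : ℕ}

lemma x_mul_x (i j : Fin n) : x K i * x K j = x K j * x K i := by
  simpa [x] using RingQuot.mkAlgHom_rel K (Rel.x_comm (K := K) i j)

lemma d_mul_d (i j : Fin n) : d K i * d K j = d K j * d K i := by
  simpa [d] using RingQuot.mkAlgHom_rel K (Rel.d_comm (K := K) i j)

lemma d_mul_x_of_ne {i j : Fin n} (h : i ≠ j) : d K i * x K j = x K j * d K i := by
  simpa [x, d] using RingQuot.mkAlgHom_rel K (Rel.d_x_of_ne (K := K) i j h)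

lemma d_mul_x (i : Fin n) : d K i * x K i = x K i * d K i + 1 := by
  simpa [x, d] using RingQuot.mkAlgHom_rel K (Rel.d_x (K := K) i)

/-- The generators of the Weyl algebra as one family. -/
def gen (v : Fin n ⊕ Fin n) : WeylAlgebra K n := Sum.elim (x K) (d K) v

/-- The monomials of the Weyl algebra, with the two exponents joined into one. -/
def mon (ξ : Fin n ⊕ Fin n → ℕ) : WeylAlgebra K n := mono K (fun i => ξ (.inl i)) fun i => ξ (.inr i)

lemma mon_zero : mon K (0 : Fin n ⊕ Fin n → ℕ) = 1 := by
  simp [mon, mono]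

/-- Multiplication of a monomial by a generator, up to smaller terms. -/
lemma gen_mul_mon (v : Fin n ⊕ Fin n) (ξ : Fin n ⊕ Fin n → ℕ) :
    ∃ N : ℕ, ∃ η ≤ ξ, gen K v * mon K ξ = mon K (ξ + Pi.single v 1) + N • mon K η := by
  rcases v with i | i
  · refine ⟨0, ξ, le_rfl, ?_⟩
    have h := mul_prod_ofFn_pow (x K) (x_mul_x K) (fun j => ξ (.inl j)) i
    simp only [gen, mon, mono, Sum.elim_inl]
    rw [← mul_assoc, h]
    simp [Pi.single_apply]
  · refine ⟨ξ (.inl i), ξ - Pi.single (.inl i) 1, tsub_le_self, ?_⟩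
    have h1 := derivation_prod_ofFn_pow (x K) (d K i) i (fun j hj => d_mul_x_of_ne K hj)
      (d_mul_x K i) (fun j => ξ (.inl j))
    have h2 := mul_prod_ofFn_pow (d K) (d_mul_d K) (fun j => ξ (.inr j)) i
    simp only [gen, mon, mono, Sum.elim_inr]
    rw [← mul_assoc, h1, add_mul, mul_assoc, h2, smul_mul_assoc]
    simp [Pi.single_apply]

end Weyl

/-! ### Dimension of a span -/

/-- Greedy choice of a basis: vectors arrive in increasing order of `key`, and a later arrival does
not affect earlier decisions. -/
lemma exists_linearIndepOn_filter {K M T L : Type*} [Field K] [AddCommGroup M] [Module K M]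
    [LinearOrder L] (v : T → M) (key : T → L) (hkey : Function.Injective key) (S : Finset T) :
    ∃ B : Finset T, (∀ t, t ∈ B ↔ t ∈ S ∧
      v t ∉ Submodule.span K (v '' {s | s ∈ S ∧ key s < key t})) ∧
      LinearIndepOn K v (B : Set T) ∧
      Submodule.span K (v '' B) = Submodule.span K (v '' (S : Set T)) := by
  classical
  induction S using Finset.induction_on_max_value key with
  | empty => exact ⟨∅, by simp, by simp, rfl⟩
  | insert a S ha hmax ih =>
    obtain ⟨B, hB, hli, hsp⟩ := ih
    have hlt : ∀ s ∈ S, key s < key a := fun s hs =>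
      (hmax s hs).lt_of_ne fun h => ha (hkey h ▸ hs)
    have h1 : {s | s ∈ insert a S ∧ key s < key a} = (S : Set T) := by
      ext s
      simp only [mem_insert, Set.mem_ofPred_eq, mem_coe]
      constructor
      · rintro ⟨rfl | h, h'⟩
        exacts [absurd h' (lt_irrefl _), h]
      · exact fun h => ⟨.inr h, hlt s h⟩
    have h2 : ∀ t ∈ S, {s | s ∈ insert a S ∧ key s < key t} = {s | s ∈ S ∧ key s < key t} := by
      intro t ht
      ext s
      simp only [mem_insert, Set.mem_ofPred_eq]
      constructor
      · rintro ⟨rfl | h, h'⟩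
        exacts [absurd h' (hlt t ht).not_gt, ⟨h, h'⟩]
      · exact fun h => ⟨.inr h.1, h.2⟩
    by_cases hmem : v a ∈ Submodule.span K (v '' (S : Set T))
    · refine ⟨B, fun t => ?_, hli, ?_⟩
      · by_cases hta : t = a
        · subst hta
          rw [h1, hB]
          simp [ha, hmem]
        · rw [hB, mem_insert]
          simp only [hta, false_or]
          refine and_congr_right fun ht => ?_
          rw [h2 t ht]
      · rw [hsp, coe_insert, Set.image_insert_eq, Submodule.span_insert_eq_span hmem]
    · refine ⟨insert a B, fun t => ?_, ?_, ?_⟩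
      · by_cases hta : t = a
        · subst hta
          rw [h1]
          simp [hmem]
        · rw [mem_insert, hB, mem_insert]
          simp only [hta, false_or]
          refine and_congr_right fun ht => ?_
          rw [h2 t ht]
      · rw [coe_insert]
        exact hli.insert (by rwa [hsp])
      · rw [coe_insert, coe_insert, Set.image_insert_eq, Set.image_insert_eq, Submodule.span_insert,
          Submodule.span_insert, hsp]

/-- The dimension of a span is the number of vectors not in the span of the preceding ones. -/
lemma finrank_span_image_eq_ncard {K M T L : Type*} [Field K] [AddCommGroup M] [Module K M]
    [LinearOrder L] (v : T → M) (key : T → L) (hkey : Function.Injective key) {S : Set T}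
    (hS : S.Finite) :
    Module.finrank K (Submodule.span K (v '' S)) =
      {t | t ∈ S ∧ v t ∉ Submodule.span K (v '' {s | s ∈ S ∧ key s < key t})}.ncard := by
  obtain ⟨B, hB, hli, hsp⟩ := exists_linearIndepOn_filter (K := K) v key hkey hS.toFinset
  rw [hS.coe_toFinset] at hsp
  have h : {t | t ∈ S ∧ v t ∉ Submodule.span K (v '' {s | s ∈ S ∧ key s < key t})} = B := by
    ext t
    rw [mem_coe, hB]
    simp
  rw [h, Set.ncard_coe_finset, ← hsp, Set.image_eq_range]
  exact (finrank_span_eq_card hli).trans (Fintype.card_coe B)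

/-! ### The filtration of a module -/

lemma pi_nat_induction {ι : Type*} [Fintype ι] [DecidableEq ι] {P : (ι → ℕ) → Prop} (h0 : P 0)
    (h1 : ∀ δ v, P δ → P (δ + Pi.single v 1)) (δ : ι → ℕ) : P δ := by
  induction hN : ∑ v, δ v generalizing δ with
  | zero =>
    have : δ = 0 := funext fun v => Finset.sum_eq_zero_iff.1 hN v (mem_univ v)
    rwa [this]
  | succ N ih =>
    obtain ⟨v, -, hv⟩ := exists_ne_zero_of_sum_ne_zero (hN.trans_ne N.succ_ne_zero)
    have he : δ = (δ - Pi.single v 1) + Pi.single v 1 := by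
      funext w
      by_cases h : w = v
      · subst h
        simp
        omega
      · simp [h]
    rw [he]
    refine h1 _ _ (ih _ ?_)
    have := congrArg (fun δ : ι → ℕ => ∑ v, δ v) he
    simp only [Pi.add_apply, sum_add_distrib, sum_pi_single', mem_univ, if_true] at this
    omega

section Filtration

section Mdeg

variable {ι : Type*} [Fintype ι] (c : ι → Fin p)

lemma mdeg_add (ξ η : ι → ℕ) : mdeg c (ξ + η) = mdeg c ξ + mdeg c η := by
  simp [mdeg, Pi.single_add, sum_add_distrib]

lemma mdeg_zero : mdeg c 0 = 0 := by simp [mdeg]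

lemma mdeg_nonneg (ξ : ι → ℕ) : 0 ≤ mdeg c ξ :=
  sum_nonneg fun _ _ => Pi.single_nonneg.2 (Int.natCast_nonneg _)

lemma mdeg_mono {ξ η : ι → ℕ} (h : ξ ≤ η) : mdeg c ξ ≤ mdeg c η := by
  obtain ⟨δ, rfl⟩ := exists_add_of_le h
  rw [mdeg_add]
  exact le_add_of_nonneg_right (mdeg_nonneg c δ)

lemma mdeg_single [DecidableEq ι] (v : ι) : mdeg c (Pi.single v 1) = Pi.single (c v) 1 := by
  rw [mdeg, sum_eq_single v]
  · simp
  · intro w _ hw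
    simp [hw]
  · simp

lemma finite_mdeg_le (r : Fin p → ℤ) : {ξ : ι → ℕ | mdeg c ξ ≤ r}.Finite := by
  refine (Set.Finite.pi' fun v => Set.finite_Iic (r (c v)).toNat).subset fun ξ hξ v => ?_
  have h := (le_mdeg c ξ v).trans (hξ (c v))
  change ξ v ≤ (r (c v)).toNat
  omega

end Mdeg

variable {n m : ℕ} (c : Fin n → Fin p)

/-- The block of a generator. -/
def blk (v : Fin n ⊕ Fin n) : Fin p := Sum.elim c c v

lemma mdeg_blk_apply (ξ : Fin n ⊕ Fin n → ℕ) (j : Fin p) :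
    mdeg (blk c) ξ j = ordMono c j (fun i => ξ (.inl i)) fun i => ξ (.inr i) := by
  simp only [mdeg, blk, Fintype.sum_sum_type, ordMono, Sum.elim_inl, Sum.elim_inr,
    Finset.sum_apply, Pi.single_apply, sum_filter, sum_add_distrib]
  push_cast
  simp only [eq_comm (a := j)]

variable (K : Type*) [Field K] {M : Type*} [AddCommGroup M] [Module (WeylAlgebra K n) M]

/-- The element `x^α ∂^β f_i`. -/
def vec (f : Fin m → M) (t : Fin m × (Fin n ⊕ Fin n → ℕ)) : M := mon K t.2 • f t.1

lemma gen_smul_vec (f : Fin m → M) (v : Fin n ⊕ Fin n) (i : Fin m) (ξ : Fin n ⊕ Fin n → ℕ) :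
    ∃ N : ℕ, ∃ η ≤ ξ, gen K v • vec K f (i, ξ) =
      vec K f (i, ξ + Pi.single v 1) + N • vec K f (i, η) := by
  obtain ⟨N, η, hη, h⟩ := gen_mul_mon K v ξ
  exact ⟨N, η, hη, by simp only [vec]; rw [← mul_smul, h, add_smul, smul_assoc]⟩

variable [Module K M]

/-! ### Leading monomials -/

/-- An order on the monomials that is compatible with addition. -/
def lexKey (ξ : Fin n ⊕ Fin n → ℕ) : Lex (Fin (n + n) → ℕ) :=
  toLex fun k => ξ (finSumFinEquiv.symm k)

lemma lexKey_injective : Function.Injective (lexKey (n := n)) := fun ξ η h => by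
  funext v
  simpa using congrFun (toLex.injective h) (finSumFinEquiv v)

lemma lexKey_mono {ξ η : Fin n ⊕ Fin n → ℕ} (h : ξ ≤ η) : lexKey ξ ≤ lexKey η :=
  Pi.toLex_monotone fun _ => h _

lemma lexKey_add_lt_add {ξ η : Fin n ⊕ Fin n → ℕ} (h : lexKey ξ < lexKey η)
    (δ : Fin n ⊕ Fin n → ℕ) : lexKey (ξ + δ) < lexKey (η + δ) :=
  add_lt_add_left h (lexKey δ)

/-- The order on the elements `x^α ∂^β f_i`. -/
def indexKey (t : Fin m × (Fin n ⊕ Fin n → ℕ)) : Fin m ×ₗ Lex (Fin (n + n) → ℕ) :=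
  toLex (t.1, lexKey t.2)

lemma indexKey_injective : Function.Injective (indexKey (n := n) (m := m)) := fun s t h => by
  have h := Prod.ext_iff.1 (toLex.injective h)
  exact Prod.ext h.1 (lexKey_injective h.2)

lemma indexKey_lt_iff {i j : Fin m} {ξ η : Fin n ⊕ Fin n → ℕ} :
    indexKey (i, ξ) < indexKey (j, η) ↔ i < j ∨ i = j ∧ lexKey ξ < lexKey η :=
  Prod.Lex.toLex_lt_toLex

/-- The element with index `t` is a combination of smaller ones of order at most `r`. -/
def Reducible (f : Fin m → M) (r : Fin p → ℤ) (t : Fin m × (Fin n ⊕ Fin n → ℕ)) : Prop :=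
  vec K f t ∈ Submodule.span K
    (vec K f '' {s | mdeg (blk c) s.2 ≤ r ∧ indexKey s < indexKey t})

variable {c K} in
lemma vec_mem_span_lt {f : Fin m → M} {r : Fin p → ℤ} {s t : Fin m × (Fin n ⊕ Fin n → ℕ)}
    (h : mdeg (blk c) s.2 ≤ r) (hlt : indexKey s < indexKey t) :
    vec K f s ∈ Submodule.span K
      (vec K f '' {s | mdeg (blk c) s.2 ≤ r ∧ indexKey s < indexKey t}) :=
  Submodule.subset_span ⟨s, ⟨h, hlt⟩, rfl⟩

lemma Reducible.mono {f : Fin m → M} {r r' : Fin p → ℤ} (hr : r ≤ r')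
    {t : Fin m × (Fin n ⊕ Fin n → ℕ)} (h : Reducible c K f r t) : Reducible c K f r' t :=
  Submodule.span_mono (Set.image_mono fun _ (hs : _ ∧ _) => And.intro (hs.1.trans hr) hs.2) h

/-- The block of a generator, or of the homogenizing variable of a block. -/
def homBlk (v : (Fin n ⊕ Fin n) ⊕ Fin p) : Fin p := Sum.elim (blk c) id v

lemma mdeg_homBlk (ζ : (Fin n ⊕ Fin n) ⊕ Fin p → ℕ) :
    mdeg (homBlk c) ζ = mdeg (blk c) (fun v => ζ (.inl v)) + fun j => (ζ (.inr j) : ℤ) := by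
  simp only [mdeg, homBlk, Fintype.sum_sum_type (α₁ := Fin n ⊕ Fin n), Sum.elim_inl, Sum.elim_inr,
    id]
  congr 1
  exact univ_sum_single (M := fun _ => ℤ) fun j => (ζ (.inr j) : ℤ)

/-- The monomials in the generators and the homogenizing variables that are not leading
monomials. -/
def irreducibleSet (f : Fin m → M) (i : Fin m) : Set ((Fin n ⊕ Fin n) ⊕ Fin p → ℕ) :=
  {ζ | ¬ Reducible c K f (mdeg (homBlk c) ζ) (i, fun v => ζ (.inl v))}

/-- Forgetting the homogenizing variables is a bijection: their exponents are forced to be `r - mdeg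
ξ`, which turns the condition `≤ r` into `= r`. -/
lemma hilb_irreducibleSet (f : Fin m → M) (i : Fin m) (r : Fin p → ℤ) :
    hilb (homBlk c) (irreducibleSet c K f i) r =
      ({ξ | mdeg (blk c) ξ ≤ r ∧ ¬ Reducible c K f r (i, ξ)}.ncard : ℤ) := by
  unfold hilb
  rw [← Set.InjOn.ncard_image (f := fun ζ : (Fin n ⊕ Fin n) ⊕ Fin p → ℕ => fun v => ζ (.inl v))]
  · congr 2
    ext ξ
    constructor
    · rintro ⟨ζ, ⟨h, rfl⟩, rfl⟩
      refine ⟨?_, h⟩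
      rw [mdeg_homBlk]
      exact le_add_of_nonneg_right fun j => Int.natCast_nonneg _
    · rintro ⟨h, hred⟩
      have hr : mdeg (homBlk c) (Sum.elim ξ fun j => (r j - mdeg (blk c) ξ j).toNat) = r := by
        rw [mdeg_homBlk]
        funext j
        have : mdeg (blk c) ξ j ≤ r j := h j
        simp only [Sum.elim_inl, Sum.elim_inr, Pi.add_apply]
        rw [Int.toNat_of_nonneg (by omega)]
        simp
      refine ⟨Sum.elim ξ fun j => (r j - mdeg (blk c) ξ j).toNat, ⟨?_, hr⟩, rfl⟩
      rw [irreducibleSet, Set.mem_ofPred_eq, hr]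
      exact hred
  · rintro ζ ⟨-, h⟩ ζ' ⟨-, h'⟩ he
    rw [← h', mdeg_homBlk, mdeg_homBlk] at h
    simp only at he
    rw [he, add_right_inj] at h
    funext v
    rcases v with v | j
    · exact congrFun he v
    · exact_mod_cast congrFun h j

/-! ### Growth of the filtration -/

variable [IsScalarTower K (WeylAlgebra K n) M]

lemma filt_eq_span (f : Fin m → M) (r : Fin p → ℤ) :
    filt K c f r = Submodule.span K (vec K f '' {t | mdeg (blk c) t.2 ≤ r}) := by
  have hW : W K c r = Submodule.span K (mon K '' {ξ | mdeg (blk c) ξ ≤ r}) := by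
    unfold W
    congr 1
    ext D
    constructor
    · rintro ⟨α, β, h, rfl⟩
      refine ⟨Sum.elim α β, fun j => ?_, rfl⟩
      rw [mdeg_blk_apply]
      exact h j
    · rintro ⟨ξ, h, rfl⟩
      refine ⟨_, _, fun j => ?_, rfl⟩
      rw [← mdeg_blk_apply]
      exact h j
  simp only [filt, hW, Submodule.map_span]
  rw [← Submodule.span_iUnion]
  congr 1
  ext y
  simp only [Set.mem_iUnion, Set.mem_image]
  constructor
  · rintro ⟨i, _, ⟨ξ, h, rfl⟩, rfl⟩
    exact ⟨(i, ξ), h, rfl⟩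
  · rintro ⟨⟨i, ξ⟩, h, rfl⟩
    exact ⟨i, _, ⟨ξ, h, rfl⟩, rfl⟩

lemma finite_index (r : Fin p → ℤ) :
    {t : Fin m × (Fin n ⊕ Fin n → ℕ) | mdeg (blk c) t.2 ≤ r}.Finite :=
  (Set.finite_univ.prod (finite_mdeg_le (blk c) r)).subset fun _ h => ⟨trivial, h⟩

lemma filt_mono (f : Fin m → M) {r s : Fin p → ℤ} (h : r ≤ s) : filt K c f r ≤ filt K c f s := by
  rw [filt_eq_span, filt_eq_span]
  exact Submodule.span_mono (Set.image_mono fun t ht => ht.trans h)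

lemma finite_filt (f : Fin m → M) (r : Fin p → ℤ) : Module.Finite K (filt K c f r) := by
  rw [filt_eq_span]
  exact FiniteDimensional.span_of_finite K ((finite_index c r).image _)

lemma vec_mem_filt (f : Fin m → M) {r : Fin p → ℤ} {i : Fin m} {ξ : Fin n ⊕ Fin n → ℕ}
    (h : mdeg (blk c) ξ ≤ r) : vec K f (i, ξ) ∈ filt K c f r := by
  rw [filt_eq_span]
  exact Submodule.subset_span ⟨_, h, rfl⟩

lemma gen_smul_mem_span {s t : Set M} (v : Fin n ⊕ Fin n)
    (h : ∀ y ∈ s, gen K v • y ∈ Submodule.span K t) {y : M} (hy : y ∈ Submodule.span K s) :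
    gen K v • y ∈ Submodule.span K t := by
  induction hy using Submodule.span_induction with
  | mem y hy => exact h y hy
  | zero => rw [smul_zero]; exact zero_mem _
  | add y z _ _ hy hz => rw [smul_add]; exact add_mem hy hz
  | smul k y _ hy => rw [smul_comm]; exact Submodule.smul_mem _ k hy

lemma gen_smul_mem_filt (f : Fin m → M) {r : Fin p → ℤ} (v : Fin n ⊕ Fin n) {y : M}
    (hy : y ∈ filt K c f r) : gen K v • y ∈ filt K c f (r + Pi.single (blk c v) 1) := by
  rw [filt_eq_span] at hy
  rw [filt_eq_span]
  refine gen_smul_mem_span K v ?_ hy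
  rintro _ ⟨⟨i, ξ⟩, hξ, rfl⟩
  rw [← filt_eq_span]
  obtain ⟨N, η, hη, h⟩ := gen_smul_vec K f v i ξ
  have hξ' : mdeg (blk c) ξ ≤ r := hξ
  rw [h]
  refine add_mem (vec_mem_filt c K f ?_) (nsmul_mem (vec_mem_filt c K f ?_) N)
  · rw [mdeg_add, mdeg_single]
    exact add_le_add_left hξ' _
  · refine ((mdeg_mono _ hη).trans hξ').trans (le_add_of_nonneg_right ?_)
    exact Pi.single_nonneg.2 zero_le_one

lemma mon_smul_mem_filt (f : Fin m → M) {r : Fin p → ℤ} {y : M} (hy : y ∈ filt K c f r)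
    (δ : Fin n ⊕ Fin n → ℕ) : mon K δ • y ∈ filt K c f (r + mdeg (blk c) δ) := by
  -- All exponents below `δ` are treated together, because the correction in `gen_mul_mon` has an
  -- unspecified exponent below the given one.
  suffices ∀ ξ ≤ δ, mon K ξ • y ∈ filt K c f (r + mdeg (blk c) δ) from this δ le_rfl
  induction δ using pi_nat_induction with
  | h0 =>
    intro ξ hξ
    rw [le_antisymm hξ fun _ => Nat.zero_le _, mon_zero, mdeg_zero, one_smul, add_zero]
    exact hy
  | h1 δ v ih =>
    rw [mdeg_add, mdeg_single, ← add_assoc]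
    have hle : r + mdeg (blk c) δ ≤ r + mdeg (blk c) δ + Pi.single (blk c v) 1 :=
      le_add_of_nonneg_right (Pi.single_nonneg.2 zero_le_one)
    intro ξ hξ
    by_cases h : ξ v ≤ δ v
    · refine filt_mono c K f hle (ih ξ fun w => ?_)
      by_cases hw : w = v
      · rwa [hw]
      · simpa [hw] using hξ w
    · obtain ⟨ζ, hζ⟩ : ∃ ζ, ξ = ζ + Pi.single v 1 := ⟨ξ - Pi.single v 1, by
        rw [tsub_add_cancel_of_le]
        intro w
        by_cases hw : w = v
        · subst hw
          simp only [Pi.single_eq_same]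
          omega
        · simp [hw]⟩
      subst hζ
      have hζδ : ζ ≤ δ := le_of_add_le_add_right hξ
      obtain ⟨N, η, hη, h⟩ := gen_mul_mon K v ζ
      replace h := eq_sub_of_add_eq h.symm
      rw [h, sub_smul, mul_smul, smul_assoc]
      exact sub_mem (gen_smul_mem_filt c K f v (ih ζ hζδ))
        (nsmul_mem (filt_mono c K f hle (ih η (hη.trans hζδ))) N)

lemma filt_le_filt_add {q : ℕ} (f : Fin m → M) (h : Fin q → M) {s : Fin p → ℤ}
    (hs : ∀ i, f i ∈ filt K c h s) (r : Fin p → ℤ) : filt K c f r ≤ filt K c h (r + s) := by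
  rw [filt_eq_span c K f, Submodule.span_le]
  rintro _ ⟨⟨i, ξ⟩, hξ, rfl⟩
  rw [add_comm]
  exact filt_mono c K h (add_le_add_right (show mdeg (blk c) ξ ≤ r from hξ) s)
    (mon_smul_mem_filt c K h (hs i) ξ)

lemma exists_smul_mem_filt (h : Fin m → M) (a : WeylAlgebra K n) (y : M)
    (hy : ∃ s : Fin p → ℤ, y ∈ filt K c h s) : ∃ s : Fin p → ℤ, a • y ∈ filt K c h s := by
  obtain ⟨b, rfl⟩ := RingQuot.mkAlgHom_surjective K (Rel K n) a
  induction b using FreeAlgebra.induction generalizing y with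
  | grade0 k =>
    obtain ⟨s, hs⟩ := hy
    rw [AlgHom.commutes, algebraMap_smul]
    exact ⟨s, Submodule.smul_mem _ k hs⟩
  | grade1 v =>
    obtain ⟨s, hs⟩ := hy
    have hv : RingQuot.mkAlgHom K (Rel K n) (FreeAlgebra.ι K v) = gen K v := by
      rcases v with i | i <;> rfl
    rw [hv]
    exact ⟨_, gen_smul_mem_filt c K h v hs⟩
  | mul b b' hb hb' =>
    rw [map_mul, mul_smul]
    exact hb _ (hb' _ hy)
  | add b b' hb hb' =>
    rw [map_add, add_smul]
    obtain ⟨s, hs⟩ := hb _ hy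
    obtain ⟨t, ht⟩ := hb' _ hy
    exact ⟨s ⊔ t, add_mem (filt_mono c K h le_sup_left hs) (filt_mono c K h le_sup_right ht)⟩

lemma exists_mem_filt (h : Fin m → M) (hh : Submodule.span (WeylAlgebra K n) (Set.range h) = ⊤)
    (y : M) : ∃ s : Fin p → ℤ, y ∈ filt K c h s := by
  have hy : y ∈ Submodule.span (WeylAlgebra K n) (Set.range h) := hh ▸ Submodule.mem_top
  induction hy using Submodule.span_induction with
  | mem y hy =>
    obtain ⟨i, rfl⟩ := hy
    refine ⟨0, ?_⟩
    have := vec_mem_filt c K h (i := i) (mdeg_zero (blk c)).le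
    simpa [vec, mon_zero] using this
  | zero => exact ⟨0, zero_mem _⟩
  | add y z _ _ hy hz =>
    obtain ⟨s, hs⟩ := hy
    obtain ⟨t, ht⟩ := hz
    exact ⟨s ⊔ t, add_mem (filt_mono c K h le_sup_left hs) (filt_mono c K h le_sup_right ht)⟩
  | smul a y _ hy => exact exists_smul_mem_filt c K h a y hy

/-- Each of the finitely many `f i` lies in some component for `h`; a common upper bound of these is
the shift. -/
lemma exists_forall_filt_le {q : ℕ} (f : Fin m → M) (h : Fin q → M)
    (hh : Submodule.span (WeylAlgebra K n) (Set.range h) = ⊤) :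
    ∃ s : Fin p → ℤ, ∀ r, filt K c f r ≤ filt K c h (r + s) := by
  choose s hs using fun i => exists_mem_filt c K h hh (f i)
  obtain ⟨t, ht⟩ := Finite.exists_le s
  exact ⟨t, filt_le_filt_add c K f h fun i => filt_mono c K h (ht i) (hs i)⟩

lemma IsDimensionPolynomial.eventuallyLE {q : ℕ} {f : Fin m → M} {h : Fin q → M}
    {φ φ' : MvPolynomial (Fin p) ℚ} (hφ : IsDimensionPolynomial K c f φ)
    (hφ' : IsDimensionPolynomial K c h φ')
    (hh : Submodule.span (WeylAlgebra K n) (Set.range h) = ⊤) : EventuallyLE φ φ' := by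
  obtain ⟨s, hs⟩ := hφ
  obtain ⟨s', hs'⟩ := hφ'
  obtain ⟨t, ht⟩ := exists_forall_filt_le c K f h hh
  refine ⟨t, s ⊔ (s' - t), fun r hr => ?_⟩
  have h1 : s' ≤ r + t := sub_le_iff_le_add.1 (le_sup_right.trans hr)
  have h2 := hs' _ h1
  simp only [Pi.add_apply] at h2
  rw [hs r (le_sup_left.trans hr), h2]
  have := finite_filt c K h (r + t)
  exact_mod_cast Submodule.finrank_mono (ht r)

lemma IsDimensionPolynomial.unique {f : Fin m → M} {φ φ' : MvPolynomial (Fin p) ℚ}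
    (hφ : IsDimensionPolynomial K c f φ) (hφ' : IsDimensionPolynomial K c f φ') : φ = φ' := by
  obtain ⟨s, hs⟩ := hφ
  obtain ⟨s', hs'⟩ := hφ'
  exact eq_of_eval_eq_of_le (s ⊔ s') fun r hr => by
    rw [hs r (le_sup_left.trans hr), hs' r (le_sup_right.trans hr)]

/-! ### The Hilbert function of the filtration -/

/-- Multiplying the relation by a generator translates every exponent, which preserves the order.
All corrections stay within the original multidegree bound and below the new leading index. -/
lemma Reducible.add_single {f : Fin m → M} {r : Fin p → ℤ} {i : Fin m} {ξ : Fin n ⊕ Fin n → ℕ}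
    (hξ : mdeg (blk c) ξ ≤ r) (h : Reducible c K f r (i, ξ)) (v : Fin n ⊕ Fin n) :
    Reducible c K f (r + Pi.single (blk c v) 1) (i, ξ + Pi.single v 1) := by
  have hr : r ≤ r + Pi.single (blk c v) 1 :=
    le_add_of_nonneg_right (Pi.single_nonneg.2 zero_le_one)
  have hlt : lexKey ξ < lexKey (ξ + Pi.single v 1) :=
    (lexKey_mono (le_add_of_nonneg_right fun _ => Nat.zero_le _)).lt_of_ne fun he => by
      have := congrFun (lexKey_injective he) v
      simp at this
  have hsmul := gen_smul_mem_span K v (t := vec K f '' {s | mdeg (blk c) s.2 ≤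
    r + Pi.single (blk c v) 1 ∧ indexKey s < indexKey (i, ξ + Pi.single v 1)}) ?_ h
  · obtain ⟨N, η, hη, he⟩ := gen_smul_vec K f v i ξ
    rw [← sub_eq_iff_eq_add] at he
    rw [Reducible, ← he]
    refine sub_mem hsmul (nsmul_mem (vec_mem_span_lt ?_ ?_) N)
    · exact ((mdeg_mono _ hη).trans hξ).trans hr
    · exact indexKey_lt_iff.2 (.inr ⟨rfl, (lexKey_mono hη).trans_lt hlt⟩)
  · rintro _ ⟨⟨j, ζ⟩, ⟨hζ, hζlt⟩, rfl⟩
    obtain ⟨N, η, hη, he⟩ := gen_smul_vec K f v j ζ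
    have hζ' : mdeg (blk c) ζ ≤ r := hζ
    rw [he]
    refine add_mem (vec_mem_span_lt ?_ ?_)
      (nsmul_mem (vec_mem_span_lt ?_ ?_) N)
    · simp only [mdeg_add, mdeg_single]
      exact add_le_add_left hζ' _
    · rw [indexKey_lt_iff] at hζlt ⊢
      exact hζlt.imp_right fun h => ⟨h.1, lexKey_add_lt_add h.2 _⟩
    · exact ((mdeg_mono _ hη).trans hζ').trans hr
    · rw [indexKey_lt_iff] at hζlt ⊢
      exact hζlt.imp_right fun h => ⟨h.1, (lexKey_mono hη).trans_lt (h.2.trans hlt)⟩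

lemma Reducible.add {f : Fin m → M} {r : Fin p → ℤ} {i : Fin m} {ξ : Fin n ⊕ Fin n → ℕ}
    (hξ : mdeg (blk c) ξ ≤ r) (h : Reducible c K f r (i, ξ)) (δ : Fin n ⊕ Fin n → ℕ) :
    Reducible c K f (r + mdeg (blk c) δ) (i, ξ + δ) := by
  induction δ using pi_nat_induction with
  | h0 => simpa [mdeg_zero] using h
  | h1 δ v ih =>
    rw [mdeg_add, mdeg_single, ← add_assoc, ← add_assoc]
    refine Reducible.add_single c K ?_ ih v
    rw [mdeg_add]
    exact add_le_add_left hξ _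

/-- Raising a generator exponent is `Reducible.add`; raising a homogenizing exponent only enlarges
the bound `r`, which is `Reducible.mono`. -/
lemma isLowerSet_irreducibleSet (f : Fin m → M) (i : Fin m) :
    IsLowerSet (irreducibleSet c K f i) := by
  intro ζ ζ' hle hζ hred
  refine hζ ?_
  obtain ⟨δ, rfl⟩ := exists_add_of_le hle
  have h1 : mdeg (blk c) (fun v => ζ' (.inl v)) ≤ mdeg (homBlk c) ζ' := by
    rw [mdeg_homBlk]
    exact le_add_of_nonneg_right fun j => Int.natCast_nonneg _
  refine (Reducible.add c K h1 hred fun v => δ (.inl v)).mono c K ?_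
  rw [mdeg_add]
  refine add_le_add_right ?_ _
  rw [mdeg_homBlk c δ]
  exact le_add_of_nonneg_right fun j => Int.natCast_nonneg _

lemma finrank_filt_eq (f : Fin m → M) (r : Fin p → ℤ) :
    (Module.finrank K (filt K c f r) : ℤ) =
      ∑ i, hilb (homBlk c) (irreducibleSet c K f i) r := by
  have h1 : {t | t ∈ {t | mdeg (blk c) t.2 ≤ r} ∧ vec K f t ∉ Submodule.span K (vec K f ''
      {s | s ∈ {t : Fin m × (Fin n ⊕ Fin n → ℕ) | mdeg (blk c) t.2 ≤ r} ∧
        indexKey s < indexKey t})} =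
      ⋃ i, (fun ξ => (i, ξ)) '' {ξ | mdeg (blk c) ξ ≤ r ∧ ¬ Reducible c K f r (i, ξ)} := by
    ext ⟨i, ξ⟩
    simp [Reducible]
  rw [filt_eq_span, finrank_span_image_eq_ncard (vec K f) indexKey indexKey_injective
    (finite_index c r), h1]
  simp only [hilb_irreducibleSet]
  have hfin : ∀ i : Fin m, {ξ | mdeg (blk c) ξ ≤ r ∧ ¬ Reducible c K f r (i, ξ)}.Finite :=
    fun i => (finite_mdeg_le (blk c) r).subset fun _ h => h.1
  rw [Set.ncard_iUnion_of_finite (fun i => (hfin i).image _)]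
  · rw [finsum_eq_sum_of_fintype]
    push_cast
    refine sum_congr rfl fun i _ => ?_
    rw [Set.ncard_image_of_injective _ (Prod.mk_right_injective i)]
  · intro i j hij
    rw [Function.onFun, Set.disjoint_left]
    rintro _ ⟨ξ, -, rfl⟩ ⟨η, -, he⟩
    exact hij (Prod.ext_iff.1 he).1.symm

/-- Block `j` contributes `n_j` variables, `n_j` derivatives and one homogenizing variable. -/
lemma sum_single_homBlk (j : Fin p) :
    (∑ v, Pi.single (homBlk c v) 1 : Fin p → ℕ) j = 2 * blockSize c j + 1 := by
  simp only [homBlk, blk, Fintype.sum_sum_type, Sum.elim_inl, Sum.elim_inr, id,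
    Finset.sum_apply, Pi.single_apply, blockSize, card_filter]
  simp only [eq_comm (a := j), sum_ite_eq', mem_univ, if_true]
  ring

lemma exists_isDimensionPolynomial (f : Fin m → M) :
    ∃ φ a, IsDimensionPolynomial K c f φ ∧ HasExpansion c φ a := by
  have hmem : (fun r => (Module.finrank K (filt K c f r) : ℤ)) ∈
      countSpan (∑ v, Pi.single (homBlk c v) 1) := by
    have : (fun r => (Module.finrank K (filt K c f r) : ℤ)) =
        ∑ i, hilb (homBlk c) (irreducibleSet c K f i) := by
      funext r
      rw [finrank_filt_eq, Finset.sum_apply]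
    rw [this]
    exact sum_mem fun i _ => hilb_mem_countSpan _ _ (isLowerSet_irreducibleSet c K f i)
  obtain ⟨a, ha, s, hs⟩ := eventuallyExpands_of_mem_countSpan hmem
  refine ⟨_, a, ⟨s, fun r hr => ?_⟩, fun k hk j => ?_, rfl⟩
  · have := hs r hr
    rw [Int.cast_natCast] at this
    rw [this, map_sum]
    simp [Finsupp.sum, eval_binom]
  · have := ha k hk j
    rw [sum_single_homBlk] at this
    omega

end Filtration

end WeylDim

end

/-! ### The theorem. -/

open WeylDim in
theorem theorem4p4 (K : Type*) [Field K] [CharZero K] (n p : ℕ) (c : Fin n → Fin p)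
    (M : Type*) [AddCommGroup M] [Module K M] [Module (WeylDim.WeylAlgebra K n) M]
    [IsScalarTower K (WeylDim.WeylAlgebra K n) M] :
    -- every finite system of generators has exactly one dimension polynomial, and this has
    -- exactly one expansion in the binomial basis with integer coefficients
    (∀ (m : ℕ) (f : Fin m → M),
      Submodule.span (WeylDim.WeylAlgebra K n) (Set.range f) = ⊤ →
      (∃! φ : MvPolynomial (Fin p) ℚ, WeylDim.IsDimensionPolynomial K c f φ) ∧
      ∀ φ : MvPolynomial (Fin p) ℚ, WeylDim.IsDimensionPolynomial K c f φ →
        ∃! a : (Fin p → ℕ) →₀ ℤ, WeylDim.HasExpansion c φ a) ∧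
    -- the invariants agree for any two finite systems of generators
    (∀ (m q : ℕ) (f : Fin m → M) (h : Fin q → M),
      Submodule.span (WeylDim.WeylAlgebra K n) (Set.range f) = ⊤ →
      Submodule.span (WeylDim.WeylAlgebra K n) (Set.range h) = ⊤ →
      ∀ (φ φ' : MvPolynomial (Fin p) ℚ) (a b : (Fin p → ℕ) →₀ ℤ),
        WeylDim.IsDimensionPolynomial K c f φ → WeylDim.HasExpansion c φ a →
        WeylDim.IsDimensionPolynomial K c h φ' → WeylDim.HasExpansion c φ' b →
        φ.totalDegree = φ'.totalDegree ∧
        a (fun j => 2 * WeylDim.blockSize c j) = b (fun j => 2 * WeylDim.blockSize c j) ∧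
        ((∀ j, φ.degreeOf j = φ'.degreeOf j) ∧
          a (fun j => φ.degreeOf j) = b (fun j => φ'.degreeOf j)) ∧
        (WeylDim.lexMaximal (a.support : Set (Fin p → ℕ)) =
            WeylDim.lexMaximal (b.support : Set (Fin p → ℕ)) ∧
          ∀ k ∈ WeylDim.lexMaximal (a.support : Set (Fin p → ℕ)), a k = b k) ∧
        (∀ k : Fin p → ℕ, ∑ j, k j = φ.totalDegree → a k = b k) ∧
        ∀ k : Fin p →₀ ℕ, ∑ j, k j = φ.totalDegree → φ.coeff k = φ'.coeff k) := by
  have hexp : ∀ (m : ℕ) (f : Fin m → M) (φ : MvPolynomial (Fin p) ℚ),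
      IsDimensionPolynomial K c f φ → ∃ a, HasExpansion c φ a := by
    intro m f φ hφ
    obtain ⟨φ', a, hφ', ha⟩ := exists_isDimensionPolynomial c K f
    rw [hφ.unique c K hφ']
    exact ⟨a, ha⟩
  refine ⟨fun m f _ => ⟨?_, fun φ hφ => ?_⟩, ?_⟩
  · obtain ⟨φ, a, hφ, ha⟩ := exists_isDimensionPolynomial c K f
    exact ⟨φ, hφ, fun φ' hφ' => hφ'.unique c K hφ⟩
  · obtain ⟨a, ha⟩ := hexp m f φ hφ
    exact ⟨a, ha, fun b hb => hb.unique ha⟩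
  · intro m q f h hf hh φ φ' a b hφ ha hφ' hb
    have h1 : EventuallyLE φ φ' := hφ.eventuallyLE c K hφ' hh
    have h2 : EventuallyLE φ' φ := hφ'.eventuallyLE c K hφ hf
    have hdeg : ∀ j, φ.degreeOf j = φ'.degreeOf j := fun j =>
      le_antisymm (degreeOf_le_of_eventuallyLE h1 h2 j) (degreeOf_le_of_eventuallyLE h2 h1 j)
    refine ⟨totalDegree_eq_of_eventuallyLE h1 h2, ?_, ⟨hdeg, ?_⟩, ⟨?_, fun k hk => ?_⟩,
      fun k hk => ?_, fun k hk => ?_⟩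
    · exact apply_eq_of_forall_le h1 h2 ha hb ha.le_of_coeffAt_ne_zero hb.le_of_coeffAt_ne_zero
    -- With equal partial degrees, one box contains the exponents of both polynomials, and its
    -- corner is the index compared.
    · rw [← funext hdeg]
      refine apply_eq_of_forall_le h1 h2 ha hb le_degreeOf_of_coeffAt_ne_zero fun l hl => ?_
      rw [funext hdeg]
      exact le_degreeOf_of_coeffAt_ne_zero l hl
    · ext k
      exact ⟨fun hk => (lexMaximal_apply_eq h1 h2 ha hb hk).2,
        fun hk => (lexMaximal_apply_eq h2 h1 hb ha hk).2⟩
    · exact (lexMaximal_apply_eq h1 h2 ha hb hk).1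
    · exact apply_eq_of_sum_eq_totalDegree h1 h2 ha hb k hk
    · exact coeff_eq_of_sum_eq_totalDegree h1 h2 k hk
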